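/- Let $\beta>0$ and put $\lambda^{(N)}=N-\beta\sqrt N$ for $N\in\mathbb N$. Let $\tilde G_E$ be the c.d.f. of a probability distribution on $[0,\infty)$ with mean $1$ and finite variance, which is non-lattice, satisfies $\tilde G_E(x)<1$ for all $x>0$, and has a finite moment of order $2+\epsilon$ for some $\epsilon>0$. Let $G$ be the c.d.f. of a probability distribution on $[0,\infty)$ with mean $1$ and with a finite moment of order $2+\epsilon'$ for some $\epsilon'>0$, such that $G(0)=0$, $G$ is continuously differentiable on $[0,\infty)$ with derivative $g$ (one-sided at $0$), and the hazard rate $h=g/(1-G)$ is continuously differentiable on $[0,\infty)$ and bounded together with its derivative. A stationary renewal process with renewal distribution $F$ (a distribution on $[0,\infty)$ with mean $m_F\in(0,\infty)$) is the counting process $t\mapsto\#\{n\ge 0: u_0+\dots+u_n\le t\}$, $t\ge0$, where $u_0,u_1,u_2,\dots$ are independent, $u_0$ has density $(1-F(x))/m_F$ on $[0,\infty)$, and $u_1,u_2,\dots$ have distribution $F$. For each $N$ with $\lambda^{(N)}>0$ (that is, $N>\beta^2$), let $A^{(N)}$ be a stationary renewal process with renewal distribution $G_E^{(N)}(x)=\tilde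 G_E(\lambda^{(N)}x)$, let $D_1,\dots,D_N$ be i.i.d. stationary renewal processes with renewal distribution $G$, independent of $A^{(N)}$, and set $$\widehat L^{(N)}=\frac1{\sqrt N}\,\sup_{t\ge0}\Bigl(A^{(N)}(t)-\sum_{i=1}^N D_i(t)\Bigr).$$ Then $\widehat L^{(N)}$ is almost surely finite and integrable for each such $N$, and there is a constant $C_Q<\infty$, depending only on $\beta$, $\tilde G_E$ and $G$, such that $$\sup_{N\in\mathbb N,\;N>\beta^2}\mathbb E\bigl[\widehat L^{(N)}\bigr]\le C_Q .$$ -/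

import Mathlib

open MeasureTheory ProbabilityTheory Set
open scoped NNReal

noncomputable section

/-- The arrival rate `N - β √N` of the `N`-th system. -/
def arrivalRate (β : ℝ) (N : ℕ) : ℝ := N - β * √N

/-- `F` has a finite moment of order `2 + ε` for some `ε > 0`. -/
def HasFiniteTwoPlusMoment (F : Measure ℝ) : Prop :=
  ∃ ε : ℝ, 0 < ε ∧ Integrable (fun x : ℝ => |x| ^ (2 + ε)) F

/-- `F` is lattice: it is concentrated on the integer multiples of some `d > 0`. -/
def IsLatticeLaw (F : Measure ℝ) : Prop :=
  ∃ d : ℝ, 0 < d ∧ F (range fun k : ℤ => (k : ℝ) * d) = 1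

/-- The assumptions on the (unscaled) inter-arrival distribution. -/
structure IsAdmissibleInterarrivalLaw (F : Measure ℝ) : Prop where
  nonneg : F (Iio 0) = 0
  mean_eq_one : ∫ x, x ∂F = 1
  finite_variance : MemLp id 2 F
  nonlattice : ¬ IsLatticeLaw F
  full_support : ∀ x : ℝ, 0 < x → cdf F x < 1
  moment : HasFiniteTwoPlusMoment F

/-- The density `g = G'` on `[0, ∞)` of a distribution with c.d.f. `G`
(the derivative at `0` is the one-sided one). -/
def lawDensity (F : Measure ℝ) (x : ℝ) : ℝ := derivWithin (cdf F) (Ici 0) x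

/-- The hazard rate `h = g / (1 - G)` on `[0, ∞)`. -/
def hazardRate (F : Measure ℝ) (x : ℝ) : ℝ := lawDensity F x / (1 - cdf F x)

/-- `f` restricted to `[0, ∞)` lies in `C¹_b[0, ∞)`: it is continuously differentiable, and it is
bounded together with its derivative. -/
def IsC1bOnHalfLine (f : ℝ → ℝ) : Prop :=
  ContDiffOn ℝ 1 f (Ici 0) ∧
    (∃ M : ℝ, ∀ x : ℝ, 0 ≤ x → |f x| ≤ M) ∧
    (∃ M : ℝ, ∀ x : ℝ, 0 ≤ x → |derivWithin f (Ici 0) x| ≤ M)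

/-- The assumptions on the service distribution. The first field says that the law is carried by
`(0, ∞)`; together with the third it says that the law has the continuous density `g` on
`[0, ∞)`. -/
structure IsAdmissibleServiceLaw (F : Measure ℝ) : Prop where
  cdf_zero : cdf F 0 = 0
  mean_eq_one : ∫ x, x ∂F = 1
  contDiffOn_cdf : ContDiffOn ℝ 1 (cdf F) (Ici 0)
  hazardRate_mem : IsC1bOnHalfLine (hazardRate F)

/-- The equilibrium (stationary residual life) distribution of `F`, with density
`(1 - F(x)) / mean(F)` on `[0, ∞)`. -/
def equilibriumLaw (F : Measure ℝ) : Measure ℝ :=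
  (volume.restrict (Ici 0)).withDensity
    fun x => ENNReal.ofReal ((1 - cdf F x) / ∫ y, y ∂F)

/-- The inter-event times of a stationary renewal process with renewal distribution `F`:
`u 0` is the delay, with the equilibrium distribution of `F`, and `u 1, u 2, …` are the renewal
times, with distribution `F`; all of them are independent. -/
structure IsStationaryRenewalSeq {Ω : Type*} [MeasurableSpace Ω] (P : Measure Ω) (F : Measure ℝ)
    (u : ℕ → Ω → ℝ) : Prop where
  measurable : ∀ n, Measurable (u n)
  law_delay : P.map (u 0) = equilibriumLaw F
  law_renewal : ∀ n, 1 ≤ n → P.map (u n) = F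
  indep : iIndepFun u P

/-- The counting process of the events at the epochs `u 0 + ⋯ + u n`, `n = 0, 1, 2, …`:
the number of events in `[0, t]`. (It is almost surely finite for the sequences used below.) -/
def renewalCount {Ω : Type*} (u : ℕ → Ω → ℝ) (t : ℝ≥0) (ω : Ω) : ℕ :=
  {n : ℕ | ∑ i ∈ Finset.range (n + 1), u i ω ≤ (t : ℝ)}.ncard

/-- `A(t) - ∑ i, D i (t)`, where `A` is the counting process of `u` and `D i` that of `v i`. -/
def excess {Ω : Type*} {N : ℕ} (u : ℕ → Ω → ℝ) (v : Fin N → ℕ → Ω → ℝ) (t : ℝ≥0) (ω : Ω) : ℝ :=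
  (renewalCount u t ω : ℝ) - ∑ i : Fin N, (renewalCount (v i) t ω : ℝ)

/-- `N^(-1/2) sup_{t ≥ 0} (A(t) - ∑ i, D i (t))`. The supremum is a real number, meaningful where
the path of `excess` is bounded above. -/
def scaledSupremum {Ω : Type*} {N : ℕ} (u : ℕ → Ω → ℝ) (v : Fin N → ℕ → Ω → ℝ) (ω : Ω) : ℝ :=
  (1 / √(N : ℝ)) * ⨆ t : ℝ≥0, excess u v t ω

end

/-!
The excess `A - ∑ D i` has drift `-β √N`, while its fluctuations over an interval of length `t` are
of order `√(N t)`; these balance at times of order one, where both are of order `√N`. To turn this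
into a bound for the mean supremum, the drift is divided equally between the arrivals and the
services, which are then treated separately; no independence between them is needed.

Both parts are instances of `lintegral_iSup_sub_drift_le`: if `Y` is a discrete-time process
starting at `0` with `E |Y j - Y i| ^ p ≤ K (j - i) ^ (p / 2)` for some `p > 2`, then
`E sup (Y j - a j)⁺ ≤ C / a`. This is proved by dyadic chaining. The exponent must exceed `2`, and
this is where the moments of order `2 + ε` are used.

For the arrivals, `Y` is the centred random walk of the interarrival times, and the increments are
controlled by Rosenthal's inequality (`integral_abs_sum_rpow_le`, for `2 ≤ p ≤ 3`).

For the services, `Y` is the superposition of the centred counts, sampled at the times `j / N`.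
Nothing is lost between the sampling times since the counts are monotone. Rosenthal's inequality
for the sum of the `N` independent processes reduces the matter to a single stationary renewal
process, for which `E |J - τ| ^ p ≤ C (τ + τ ^ (p / 2))` is needed, `J` being the number of epochs
in an interval of length `τ` (`IsUnitMeanLaw.exists_count_moment_le`). The mean measure of the
epochs is Lebesgue measure, and `(J - k)⁺` counts the epochs in the interval whose `k`-th successor
is there too. This gives the exact dualities `E (J - k)⁺ = E (τ - V)⁺` and
`E (k - J)⁺ = E (V - τ)⁺`, with `V` the sum of `k` renewal times
(`IsStationaryRenewalSeq.lintegral_count_sub`, `IsStationaryRenewalSeq.integral_max_sub_count`).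
Summing them over `k` with weights of order `|k - τ| ^ (p - 2)` recovers the `p`-th moment of
`J - τ` from moments of random walks; for `k` much larger than `τ` a Chernoff bound is used.
-/

open scoped ENNReal

/-! ### Moments of sums of independent centred variables -/

/-- Second-order Taylor bound for `x ↦ |1 + x| ^ p` at `0`. For `|x| ≤ 1` it is Bernoulli's
inequality applied to `(1 + x) ^ (p - 2)`. -/
theorem abs_one_add_rpow_le {p : ℝ} (hp : 2 ≤ p) (hp3 : p ≤ 3) (x : ℝ) :
    |1 + x| ^ p ≤ 1 + p * x + 11 * (x ^ 2 + |x| ^ p) := by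
  rcases le_total |x| 1 with h | h
  · have hx := abs_le.1 h
    have h0 : 0 ≤ 1 + x := by linarith
    rw [abs_of_nonneg h0]
    have hB : (1 + x) ^ (p - 2) ≤ 1 + (p - 2) * x :=
      rpow_one_add_le_one_add_mul_self hx.1 (by linarith) (by linarith)
    have hE : (1 + x) ^ p = (1 + x) ^ 2 * (1 + x) ^ (p - 2) := by
      rcases h0.eq_or_lt with h1 | h1
      · rw [← h1, Real.zero_rpow (by linarith)]; simp
      · rw [← Real.rpow_natCast, ← Real.rpow_add h1]; norm_num
    have h2 : (1 + x) ^ p ≤ (1 + x) ^ 2 * (1 + (p - 2) * x) := by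
      rw [hE]; exact mul_le_mul_of_nonneg_left hB (sq_nonneg _)
    have h3 : 0 ≤ |x| ^ p := by positivity
    have h4 : (p - 2) * x ≤ 1 := by nlinarith
    nlinarith [mul_le_mul_of_nonneg_right h4 (sq_nonneg x),
      mul_nonneg (sub_nonneg.2 hp3) (sq_nonneg x), sq_nonneg x]
  · have h1 : |x| ≤ |x| ^ p := by
      simpa using Real.rpow_le_rpow_of_exponent_le h (show (1 : ℝ) ≤ p by linarith)
    have h2 : |1 + x| ^ p ≤ 8 * |x| ^ p := by
      have : |1 + x| ≤ 2 * |x| := (abs_add_le _ _).trans (by simp; linarith)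
      refine (Real.rpow_le_rpow (abs_nonneg _) this (by linarith)).trans ?_
      rw [Real.mul_rpow (by norm_num) (abs_nonneg _)]
      gcongr
      calc (2 : ℝ) ^ p ≤ 2 ^ (3 : ℝ) := Real.rpow_le_rpow_of_exponent_le (by norm_num) hp3
        _ = 8 := by norm_num
    have h3 : -(3 * |x|) ≤ p * x := by
      have := neg_abs_le x
      nlinarith [abs_nonneg x]
    nlinarith [sq_nonneg x]

theorem abs_add_rpow_le {p : ℝ} (hp : 2 ≤ p) (hp3 : p ≤ 3) (a b : ℝ) :
    |a + b| ^ p ≤ |a| ^ p + p * (a * |a| ^ (p - 2)) * b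
      + 11 * (|a| ^ (p - 2) * b ^ 2 + |b| ^ p) := by
  rcases eq_or_ne a 0 with rfl | ha
  · have h1 : 0 ≤ |b| ^ p := by positivity
    have h2 : 0 ≤ |(0 : ℝ)| ^ (p - 2) * b ^ 2 := by positivity
    have h3 : |(0 : ℝ)| ^ p = 0 := by rw [abs_zero, Real.zero_rpow (by linarith)]
    simp only [zero_add, h3, zero_mul, mul_zero]
    linarith
  · have ha' : 0 < |a| := abs_pos.2 ha
    have h := mul_le_mul_of_nonneg_left (abs_one_add_rpow_le hp hp3 (b / a))
      (Real.rpow_nonneg ha'.le p)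
    rw [← Real.mul_rpow ha'.le (abs_nonneg _), ← abs_mul,
      show a * (1 + b / a) = a + b by field_simp] at h
    refine h.trans_eq ?_
    have e1 : |a| ^ p * |b / a| ^ p = |b| ^ p := by
      rw [← Real.mul_rpow ha'.le (abs_nonneg _), ← abs_mul, mul_div_cancel₀ _ ha]
    have e2 : |a| ^ p = |a| ^ (p - 2) * a ^ 2 := by
      rw [← sq_abs a, ← Real.rpow_natCast, ← Real.rpow_add ha']; norm_num
    have e3 : |a| ^ p * (b / a) = a * |a| ^ (p - 2) * b := by
      rw [e2]; field_simp
    have e4 : |a| ^ p * (b / a) ^ 2 = |a| ^ (p - 2) * b ^ 2 := by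
      rw [e2]; field_simp
    linear_combination p * e3 + 11 * e4 + 11 * e1

/-- Interpolation of `x ^ q` between `1` and `x ^ 2`, at the scale `√A`. -/
theorem abs_rpow_le_interpolate {q A : ℝ} (hq : 0 ≤ q) (hq2 : q ≤ 2) (hA : 0 < A) (x : ℝ) :
    |x| ^ q ≤ A ^ (q / 2) + A ^ (q / 2 - 1) * x ^ 2 := by
  have e : (|x| ^ q) = (x ^ 2) ^ (q / 2) := by
    rw [← sq_abs, ← Real.rpow_natCast, ← Real.rpow_mul (abs_nonneg _)]; congr 1; push_cast; ring
  rw [e]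
  rcases le_total (x ^ 2) A with h | h
  · have : 0 ≤ A ^ (q / 2 - 1) * x ^ 2 := by positivity
    have := Real.rpow_le_rpow (sq_nonneg x) h (show 0 ≤ q / 2 by linarith)
    linarith
  · have hx : 0 < x ^ 2 := hA.trans_le h
    have h1 : (x ^ 2) ^ (q / 2) = (x ^ 2) ^ (q / 2 - 1) * x ^ 2 := by
      rw [Real.rpow_sub_one hx.ne', div_mul_cancel₀ _ hx.ne']
    have h2 : (x ^ 2) ^ (q / 2 - 1) ≤ A ^ (q / 2 - 1) :=
      Real.rpow_le_rpow_of_nonpos hA h (by linarith)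
    have h3 := mul_le_mul_of_nonneg_right h2 hx.le
    have h4 : 0 ≤ A ^ (q / 2) := by positivity
    linarith

theorem integrable_abs_rpow_of_le {Ω : Type*} [MeasurableSpace Ω] {P : Measure Ω}
    [IsFiniteMeasure P] {X : Ω → ℝ} {p q : ℝ} (hX : Measurable X) (hq : 0 ≤ q) (hqp : q ≤ p)
    (h : Integrable (fun ω => |X ω| ^ p) P) : Integrable (fun ω => |X ω| ^ q) P := by
  refine Integrable.mono' ((integrable_const (1 : ℝ)).add h)
    (hX.abs.pow_const q).aestronglyMeasurable (ae_of_all _ fun ω => ?_)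
  rw [Real.norm_of_nonneg (by positivity)]
  rcases le_total |X ω| 1 with h1 | h1
  · have := Real.rpow_le_one (abs_nonneg _) h1 hq
    have h2 : 0 ≤ |X ω| ^ p := by positivity
    simp only [Pi.add_apply]; linarith
  · have := Real.rpow_le_rpow_of_exponent_le h1 hqp
    simp only [Pi.add_apply]; linarith

theorem integrable_of_integrable_abs_rpow {Ω : Type*} [MeasurableSpace Ω] {P : Measure Ω}
    [IsFiniteMeasure P] {X : Ω → ℝ} {p : ℝ} (hX : Measurable X) (hp : 1 ≤ p)
    (h : Integrable (fun ω => |X ω| ^ p) P) : Integrable X P := by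
  have := integrable_abs_rpow_of_le hX zero_le_one hp h
  simp only [Real.rpow_one] at this
  exact (integrable_norm_iff hX.aestronglyMeasurable).1 this

theorem integrable_sq_of_integrable_abs_rpow {Ω : Type*} [MeasurableSpace Ω] {P : Measure Ω}
    [IsFiniteMeasure P] {X : Ω → ℝ} {p : ℝ} (hX : Measurable X) (hp : 2 ≤ p)
    (h : Integrable (fun ω => |X ω| ^ p) P) : Integrable (fun ω => X ω ^ 2) P := by
  have := integrable_abs_rpow_of_le hX zero_le_two hp h
  simpa using this

/-- Adding an independent centred variable: the first-order term of the Taylor expansion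
integrates to `0`. -/
theorem integral_abs_add_rpow_le {Ω : Type*} [MeasurableSpace Ω] {P : Measure Ω}
    [IsProbabilityMeasure P] {p : ℝ} (hp : 2 ≤ p) (hp3 : p ≤ 3) {X Y : Ω → ℝ}
    (hX : Measurable X) (hY : Measurable Y) (hXY : IndepFun X Y P) (hY0 : ∫ ω, Y ω ∂P = 0)
    (hXp : Integrable (fun ω => |X ω| ^ p) P) (hYp : Integrable (fun ω => |Y ω| ^ p) P) :
    Integrable (fun ω => |X ω + Y ω| ^ p) P ∧
      ∫ ω, |X ω + Y ω| ^ p ∂P ≤ ∫ ω, |X ω| ^ p ∂P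
        + 11 * ((∫ ω, |X ω| ^ (p - 2) ∂P) * (∫ ω, Y ω ^ 2 ∂P) + ∫ ω, |Y ω| ^ p ∂P) := by
  have hq : Integrable (fun ω => |X ω| ^ (p - 2)) P :=
    integrable_abs_rpow_of_le hX (by linarith) (by linarith) hXp
  have hYi : Integrable Y P := integrable_of_integrable_abs_rpow hY (by linarith) hYp
  have hY2 : Integrable (fun ω => Y ω ^ 2) P := integrable_sq_of_integrable_abs_rpow hY hp hYp
  have hφm : Measurable fun x : ℝ => x * |x| ^ (p - 2) := by fun_prop
  have hφ : Integrable (fun ω => X ω * |X ω| ^ (p - 2)) P := by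
    have h1 := integrable_abs_rpow_of_le hX (show 0 ≤ p - 1 by linarith)
      (show p - 1 ≤ p by linarith) hXp
    refine h1.mono (hφm.comp hX).aestronglyMeasurable (ae_of_all _ fun ω => ?_)
    rw [Real.norm_eq_abs, Real.norm_eq_abs, abs_mul,
      abs_of_nonneg (Real.rpow_nonneg (abs_nonneg (X ω)) (p - 2)),
      abs_of_nonneg (Real.rpow_nonneg (abs_nonneg (X ω)) (p - 1))]
    rcases (abs_nonneg (X ω)).eq_or_lt with h | h
    · rw [← h, zero_mul]; positivity
    · rw [mul_comm, ← Real.rpow_add_one h.ne']; apply le_of_eq; congr 1; ring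
  have i1 : Integrable (fun ω => (X ω * |X ω| ^ (p - 2)) * Y ω) P :=
    (hXY.comp hφm measurable_id).integrable_mul hφ hYi
  have z1 : ∫ ω, (X ω * |X ω| ^ (p - 2)) * Y ω ∂P = 0 := by
    have := (hXY.comp hφm measurable_id).integral_mul_eq_mul_integral
      (hφm.comp hX).aestronglyMeasurable hY.aestronglyMeasurable
    refine this.trans ?_
    simp [hY0]
  have hψm : Measurable fun x : ℝ => |x| ^ (p - 2) := by fun_prop
  have hsm : Measurable fun x : ℝ => x ^ 2 := by fun_prop
  have i2 : Integrable (fun ω => |X ω| ^ (p - 2) * Y ω ^ 2) P :=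
    (hXY.comp hψm hsm).integrable_mul hq hY2
  have z2 : ∫ ω, |X ω| ^ (p - 2) * Y ω ^ 2 ∂P
      = (∫ ω, |X ω| ^ (p - 2) ∂P) * ∫ ω, Y ω ^ 2 ∂P :=
    (hXY.comp hψm hsm).integral_mul_eq_mul_integral
      (hψm.comp hX).aestronglyMeasurable (hsm.comp hY).aestronglyMeasurable
  have hb : ∀ ω, |X ω + Y ω| ^ p ≤ |X ω| ^ p + p * ((X ω * |X ω| ^ (p - 2)) * Y ω)
      + 11 * (|X ω| ^ (p - 2) * Y ω ^ 2 + |Y ω| ^ p) := fun ω => by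
    rw [← mul_assoc]; exact abs_add_rpow_le hp hp3 _ _
  have j1 : Integrable (fun ω => |X ω| ^ p + p * ((X ω * |X ω| ^ (p - 2)) * Y ω)) P :=
    hXp.add (i1.const_mul p)
  have j2 : Integrable (fun ω => |X ω| ^ (p - 2) * Y ω ^ 2 + |Y ω| ^ p) P := i2.add hYp
  have ib := j1.add (j2.const_mul 11)
  have hI : Integrable (fun ω => |X ω + Y ω| ^ p) P := by
    refine ib.mono' ((hX.add hY).abs.pow_const p).aestronglyMeasurable (ae_of_all _ fun ω => ?_)
    rw [Real.norm_of_nonneg (by positivity)]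
    exact hb ω
  refine ⟨hI, (integral_mono hI ib hb).trans_eq ?_⟩
  simp only [Pi.add_apply]
  rw [integral_add j1 (j2.const_mul 11), integral_add hXp (i1.const_mul p), integral_const_mul,
    z1, integral_const_mul, integral_add i2 hYp, z2]
  ring

/-- Rosenthal's inequality for `2 ≤ p ≤ 3`. -/
theorem integral_abs_sum_rpow_le {ι Ω : Type*} [MeasurableSpace Ω] {P : Measure Ω}
    [IsProbabilityMeasure P] {p : ℝ} (hp : 2 ≤ p) (hp3 : p ≤ 3) {Y : ι → Ω → ℝ}
    (hY : ∀ i, Measurable (Y i)) (hind : iIndepFun Y P) (hY0 : ∀ i, ∫ ω, Y i ω ∂P = 0)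
    (hYp : ∀ i, Integrable (fun ω => |Y i ω| ^ p) P) {a b : ℝ} (ha : 0 < a)
    (hYa : ∀ i, ∫ ω, Y i ω ^ 2 ∂P ≤ a) (hYb : ∀ i, ∫ ω, |Y i ω| ^ p ∂P ≤ b) (s : Finset ι) :
    Integrable (fun ω => |∑ i ∈ s, Y i ω| ^ p) P ∧
      ∫ ω, |∑ i ∈ s, Y i ω| ^ p ∂P ≤ 110 * ((s.card * a) ^ (p / 2) + s.card * b) := by
  classical
  have key : Integrable (fun ω => |∑ i ∈ s, Y i ω| ^ p) P ∧
      ∫ ω, (∑ i ∈ s, Y i ω) ^ 2 ∂P ≤ 22 * (s.card * a) ∧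
      ∫ ω, |∑ i ∈ s, Y i ω| ^ p ∂P
        ≤ 11 * (s.card * (2 * (22 * (s.card * a)) ^ (p / 2 - 1) * a + b)) := by
    induction s using Finset.induction_on with
    | empty =>
      simp [Real.zero_rpow (show p ≠ 0 by linarith)]
    | insert j s hj ih =>
      obtain ⟨h1, h2, h3⟩ := ih
      set X : Ω → ℝ := fun ω => ∑ i ∈ s, Y i ω with hXd
      have hX : Measurable X := by fun_prop
      have hXY : IndepFun X (Y j) P := by
        have := hind.indepFun_finsetSum_of_notMem hY hj
        convert this using 1
        ext ω; simp [hXd]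
      have hins : ∀ ω, ∑ i ∈ insert j s, Y i ω = X ω + Y j ω := fun ω => by
        rw [Finset.sum_insert hj, add_comm]
      simp only [hins, Finset.card_insert_of_notMem hj]
      obtain ⟨g1, g2⟩ := integral_abs_add_rpow_le hp hp3 hX (hY j) hXY (hY0 j) h1 (hYp j)
      have two : ∀ {Z : Ω → ℝ}, (fun ω => |Z ω| ^ (2 : ℝ)) = fun ω => Z ω ^ 2 := by
        intro Z; ext ω; simp
      have hXs : Integrable (fun ω => X ω ^ 2) P := integrable_sq_of_integrable_abs_rpow hX hp h1
      have hYs : Integrable (fun ω => Y j ω ^ 2) P :=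
        integrable_sq_of_integrable_abs_rpow (hY j) hp (hYp j)
      obtain ⟨-, g4⟩ := integral_abs_add_rpow_le le_rfl (by norm_num) hX (hY j) hXY (hY0 j)
        (by rw [two]; exact hXs) (by rw [two]; exact hYs)
      have hs0 : (0 : ℝ) ≤ s.card := by positivity
      refine ⟨g1, ?_, g2.trans ?_⟩
      · simp only [Real.rpow_two, sq_abs, sub_self, Real.rpow_zero, integral_const,
          probReal_univ, smul_eq_mul, mul_one, one_mul] at g4
        push_cast
        linarith [hYa j]
      · -- interpolate `E|X|^(p-2)` at the scale of the second moment of the enlarged sum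
        set A : ℝ := 22 * ((s.card + 1 : ℕ) * a) with hA
        have hA0 : 0 < A := by positivity
        have hle : 22 * (s.card * a) ≤ A := by rw [hA]; gcongr; simp
        have h5 : ∫ ω, |X ω| ^ (p - 2) ∂P ≤ 2 * A ^ (p / 2 - 1) := by
          have hpt : ∀ ω, |X ω| ^ (p - 2) ≤ A ^ (p / 2 - 1) + A ^ (p / 2 - 1 - 1) * X ω ^ 2 :=
            fun ω => by
              have := abs_rpow_le_interpolate (q := p - 2) (by linarith) (by linarith) hA0 (X ω)
              rwa [show (p - 2) / 2 = p / 2 - 1 by ring] at this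
          have := integral_mono (integrable_abs_rpow_of_le hX (by linarith) (by linarith) h1)
            ((integrable_const _).add (hXs.const_mul _)) hpt
          simp only [Pi.add_apply] at this
          rw [integral_add (integrable_const _) (hXs.const_mul _), integral_const_mul] at this
          simp only [integral_const, probReal_univ, smul_eq_mul, one_mul] at this
          have h6 : A ^ (p / 2 - 1 - 1) * ∫ ω, X ω ^ 2 ∂P ≤ A ^ (p / 2 - 1) := by
            calc _ ≤ A ^ (p / 2 - 1 - 1) * A := by gcongr; exact h2.trans hle
              _ = _ := by rw [Real.rpow_sub_one hA0.ne']; field_simp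
          linarith
        have h7 : (22 * (s.card * a)) ^ (p / 2 - 1) ≤ A ^ (p / 2 - 1) :=
          Real.rpow_le_rpow (by positivity) hle (by linarith)
        have h8 : (∫ ω, |X ω| ^ (p - 2) ∂P) * ∫ ω, Y j ω ^ 2 ∂P ≤ 2 * A ^ (p / 2 - 1) * a :=
          mul_le_mul h5 (hYa j) (integral_nonneg fun _ => sq_nonneg _) (by positivity)
        have h9 := mul_le_mul_of_nonneg_right h7 ha.le
        have h10 := mul_le_mul_of_nonneg_left h9 hs0
        push_cast
        nlinarith [hYb j]
  refine ⟨key.1, key.2.2.trans ?_⟩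
  rcases s.card.eq_zero_or_pos with h0 | h0
  · simp only [h0, Nat.cast_zero, zero_mul, mul_zero, add_zero]
    positivity
  · set n : ℝ := (s.card : ℝ)
    have hn : 0 < n := by simp only [n]; exact_mod_cast h0
    have hna : 0 < n * a := by positivity
    have hb0 : 0 ≤ n * b := by
      obtain ⟨i, -⟩ := Finset.card_pos.1 h0
      have : 0 ≤ b := (integral_nonneg fun ω => by positivity).trans (hYb i)
      positivity
    have h1 : (22 * (n * a)) ^ (p / 2 - 1) ≤ 5 * (n * a) ^ (p / 2 - 1) := by
      rw [Real.mul_rpow (by norm_num) hna.le]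
      gcongr
      calc (22 : ℝ) ^ (p / 2 - 1) ≤ 25 ^ (p / 2 - 1) :=
            Real.rpow_le_rpow (by norm_num) (by norm_num) (by linarith)
        _ ≤ 25 ^ (1 / 2 : ℝ) := Real.rpow_le_rpow_of_exponent_le (by norm_num) (by linarith)
        _ = 5 := by
          rw [← Real.sqrt_eq_rpow, show (25 : ℝ) = 5 ^ 2 by norm_num,
            Real.sqrt_sq (by norm_num)]
    have h2 : (n * a) ^ (p / 2) = (n * a) ^ (p / 2 - 1) * (n * a) := by
      rw [Real.rpow_sub_one hna.ne']; field_simp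
    rw [h2]
    nlinarith [mul_le_mul_of_nonneg_right h1 hna.le]

/-! ### A maximal inequality for processes with controlled increments -/

/-- The maximum of `|Y j|` over `j ≤ 2 ^ m`. -/
noncomputable def dyadicMax {Ω : Type*} (Y : ℕ → Ω → ℝ) (m : ℕ) (ω : Ω) : ℝ≥0∞ :=
  (Finset.range (2 ^ m + 1)).sup fun j => ‖Y j ω‖ₑ

theorem enorm_le_dyadicMax {Ω : Type*} (Y : ℕ → Ω → ℝ) {m j : ℕ} (hj : j ≤ 2 ^ m) (ω : Ω) :
    ‖Y j ω‖ₑ ≤ dyadicMax Y m ω :=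
  Finset.le_sup (f := fun j => ‖Y j ω‖ₑ) (Finset.mem_range.2 (Nat.lt_succ_of_le hj))

theorem measurable_dyadicMax {Ω : Type*} [MeasurableSpace Ω] {Y : ℕ → Ω → ℝ}
    (hY : ∀ j, Measurable (Y j)) (m : ℕ) : Measurable (dyadicMax Y m) := by
  have : dyadicMax Y m = fun ω => ⨆ j ∈ Finset.range (2 ^ m + 1), ‖Y j ω‖ₑ := by
    ext ω; rw [dyadicMax, Finset.sup_eq_iSup]
  rw [this]
  exact Measurable.biSup _ (Finset.countable_toSet _) fun j _ => (hY j).enorm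

/-- Passing from the even times to all times costs the increments over the intervals
`[2 i, 2 i + 1]`. -/
theorem dyadicMax_succ_le {Ω : Type*} (Y : ℕ → Ω → ℝ) (m : ℕ) {p : ℝ} (hp : 0 < p) (ω : Ω) :
    dyadicMax Y (m + 1) ω ≤ dyadicMax (fun j => Y (2 * j)) m ω
      + (∑ i ∈ Finset.range (2 ^ m), ‖Y (2 * i + 1) ω - Y (2 * i) ω‖ₑ ^ p) ^ (1 / p) := by
  refine Finset.sup_le fun j hj => ?_
  have hj' : j ≤ 2 * 2 ^ m := by
    have := Finset.mem_range.1 hj; rw [pow_succ] at this; omega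
  rcases Nat.even_or_odd' j with ⟨i, rfl | rfl⟩
  · exact (enorm_le_dyadicMax (fun j => Y (2 * j)) (by omega) ω).trans le_self_add
  · have h1 : ‖Y (2 * i + 1) ω‖ₑ ≤ ‖Y (2 * i) ω‖ₑ + ‖Y (2 * i + 1) ω - Y (2 * i) ω‖ₑ := by
      calc _ = ‖Y (2 * i) ω + (Y (2 * i + 1) ω - Y (2 * i) ω)‖ₑ := by congr 1; ring
        _ ≤ _ := enorm_add_le _ _
    refine h1.trans (add_le_add
      (enorm_le_dyadicMax (fun j => Y (2 * j)) (by omega) ω) ?_)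
    have h2 : ‖Y (2 * i + 1) ω - Y (2 * i) ω‖ₑ
        = (‖Y (2 * i + 1) ω - Y (2 * i) ω‖ₑ ^ p) ^ (1 / p) := by
      rw [← ENNReal.rpow_mul, mul_one_div_cancel hp.ne', ENNReal.rpow_one]
    rw [h2]
    refine ENNReal.rpow_le_rpow ?_ (by positivity)
    exact Finset.single_le_sum
      (f := fun i => ‖Y (2 * i + 1) ω - Y (2 * i) ω‖ₑ ^ p) (fun _ _ => zero_le)
      (Finset.mem_range.2 (by omega))

/-- The constants `(D + 1) x ^ m - D y ^ m`, `x = √2`, `y = 2 ^ (1 / p)`, dominate the solution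
of the recursion `B (m + 1) = x * B m + y ^ m` to which Minkowski's inequality leads. -/
theorem lintegral_dyadicMax_rpow_le_aux {Ω : Type*} [MeasurableSpace Ω] {P : Measure Ω} {p : ℝ}
    (hp : 1 ≤ p) {x y D : ℝ} (hx : x = 2 ^ (1 / 2 : ℝ)) (hy : y = 2 ^ (1 / p)) (hyx : y < x)
    (hD : D = 1 / (x - y)) (m : ℕ) :
    ∀ (Y : ℕ → Ω → ℝ) (K : ℝ≥0∞), (∀ j, Measurable (Y j)) → (∀ ω, Y 0 ω = 0) →
      (∀ i j, i ≤ j →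
        ∫⁻ ω, ‖Y j ω - Y i ω‖ₑ ^ p ∂P ≤ K * ((j - i : ℕ) : ℝ≥0∞) ^ (p / 2)) →
      (∫⁻ ω, dyadicMax Y m ω ^ p ∂P) ^ (1 / p)
        ≤ K ^ (1 / p) * ENNReal.ofReal ((D + 1) * x ^ m - D * y ^ m) := by
  have hp0 : 0 < p := by linarith
  have hy0 : 0 < y := by rw [hy]; positivity
  have hD0 : 0 < D := by rw [hD]; exact one_div_pos.2 (by linarith)
  induction m with
  | zero =>
    intro Y K hY h0 hK
    have h1 : ∀ ω, dyadicMax Y 0 ω = ‖Y 1 ω - Y 0 ω‖ₑ := fun ω => by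
      simp [dyadicMax, h0, Finset.range_add_one]
    simp only [h1]
    calc _ ≤ (K * ((1 - 0 : ℕ) : ℝ≥0∞) ^ (p / 2)) ^ (1 / p) :=
          ENNReal.rpow_le_rpow (hK 0 1 zero_le_one) (by positivity)
      _ = _ := by simp
  | succ m ih =>
    intro Y K hY h0 hK
    have hE := ih (fun j => Y (2 * j)) (K * 2 ^ (p / 2)) (fun j => hY _) (by simpa using h0)
      (fun i j hij => by
        refine (hK (2 * i) (2 * j) (by omega)).trans_eq ?_
        rw [← Nat.mul_sub, Nat.cast_mul, ENNReal.mul_rpow_of_nonneg _ _ (by positivity), mul_assoc]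
        simp)
    have hK' : (K * 2 ^ (p / 2)) ^ (1 / p) = K ^ (1 / p) * ENNReal.ofReal x := by
      rw [ENNReal.mul_rpow_of_nonneg _ _ (by positivity), ← ENNReal.rpow_mul, hx,
        ← ENNReal.ofReal_rpow_of_pos (by norm_num), ENNReal.ofReal_ofNat]
      congr 2; field_simp
    set S : Ω → ℝ≥0∞ := fun ω =>
      (∑ i ∈ Finset.range (2 ^ m), ‖Y (2 * i + 1) ω - Y (2 * i) ω‖ₑ ^ p) ^ (1 / p) with hS
    have hΔm : ∀ i, Measurable fun ω => ‖Y (2 * i + 1) ω - Y (2 * i) ω‖ₑ ^ p := fun i =>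
      ((hY _).sub (hY _)).enorm.pow_const p
    have hSm : Measurable S := (Finset.measurable_sum _ fun i _ => hΔm i).pow_const _
    have hSp : (∫⁻ ω, S ω ^ p ∂P) ^ (1 / p) ≤ K ^ (1 / p) * ENNReal.ofReal (y ^ m) := by
      have h1 : ∀ ω, S ω ^ p
          = ∑ i ∈ Finset.range (2 ^ m), ‖Y (2 * i + 1) ω - Y (2 * i) ω‖ₑ ^ p := fun ω => by
        rw [hS, ← ENNReal.rpow_mul, one_div_mul_cancel hp0.ne', ENNReal.rpow_one]
      simp only [h1]
      rw [lintegral_finsetSum _ fun i _ => hΔm i]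
      have h2 : ∑ i ∈ Finset.range (2 ^ m), ∫⁻ ω, ‖Y (2 * i + 1) ω - Y (2 * i) ω‖ₑ ^ p ∂P
          ≤ K * 2 ^ m := by
        refine (Finset.sum_le_card_nsmul _ _ K fun i _ => ?_).trans_eq ?_
        · simpa using hK (2 * i) (2 * i + 1) (by omega)
        · simp [mul_comm]
      refine (ENNReal.rpow_le_rpow h2 (by positivity)).trans_eq ?_
      rw [ENNReal.mul_rpow_of_nonneg _ _ (by positivity), hy, ENNReal.ofReal_pow (by positivity),
        ← ENNReal.ofReal_rpow_of_pos (by norm_num), ENNReal.ofReal_ofNat, ← ENNReal.rpow_natCast,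
        ← ENNReal.rpow_natCast, ← ENNReal.rpow_mul, ← ENNReal.rpow_mul, mul_comm (m : ℝ)]
    calc (∫⁻ ω, dyadicMax Y (m + 1) ω ^ p ∂P) ^ (1 / p)
        ≤ (∫⁻ ω, (dyadicMax (fun j => Y (2 * j)) m + S) ω ^ p ∂P) ^ (1 / p) := by
          refine ENNReal.rpow_le_rpow (lintegral_mono fun ω => ?_) (by positivity)
          exact ENNReal.rpow_le_rpow (dyadicMax_succ_le Y m hp0 ω) hp0.le
      _ ≤ _ := ENNReal.lintegral_Lp_add_le
          (measurable_dyadicMax (fun j => hY (2 * j)) m).aemeasurable hSm.aemeasurable hp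
      _ ≤ K ^ (1 / p) * ENNReal.ofReal x * ENNReal.ofReal ((D + 1) * x ^ m - D * y ^ m)
          + K ^ (1 / p) * ENNReal.ofReal (y ^ m) := add_le_add (hE.trans_eq (by rw [hK'])) hSp
      _ = K ^ (1 / p) * ENNReal.ofReal (x * ((D + 1) * x ^ m - D * y ^ m) + y ^ m) := by
          have h1 : y ^ m ≤ x ^ m := pow_le_pow_left₀ hy0.le hyx.le m
          have h2 : 0 ≤ (D + 1) * x ^ m - D * y ^ m := by
            have : 0 ≤ y ^ m := by positivity
            nlinarith
          have hx0 : 0 ≤ x := by linarith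
          rw [ENNReal.ofReal_add (by positivity) (by positivity), ENNReal.ofReal_mul hx0,
            mul_add, mul_assoc]
      _ ≤ _ := by
          gcongr
          have : D * (x - y) = 1 := by rw [hD]; field_simp [sub_ne_zero.2 hyx.ne']
          rw [pow_succ, pow_succ]
          apply le_of_eq
          linear_combination (-y ^ m) * this

/-- If the `p`-th moments of the increments are of the diffusive order with some `p > 2`, then so
are those of the running maximum: the dyadic levels form a geometric series. -/
theorem lintegral_dyadicMax_rpow_le {p : ℝ} (hp : 2 < p) :
    ∃ B : ℝ, 0 ≤ B ∧ ∀ {Ω : Type*} [MeasurableSpace Ω] {P : Measure Ω} (Y : ℕ → Ω → ℝ) (K : ℝ≥0∞),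
      (∀ j, Measurable (Y j)) → (∀ ω, Y 0 ω = 0) →
      (∀ i j, i ≤ j →
        ∫⁻ ω, ‖Y j ω - Y i ω‖ₑ ^ p ∂P ≤ K * ((j - i : ℕ) : ℝ≥0∞) ^ (p / 2)) →
      ∀ m : ℕ, ∫⁻ ω, dyadicMax Y m ω ^ p ∂P
        ≤ K * ENNReal.ofReal (B * ((2 : ℝ) ^ m) ^ (p / 2)) := by
  have hp0 : 0 < p := by linarith
  set x : ℝ := 2 ^ (1 / 2 : ℝ) with hx
  set y : ℝ := 2 ^ (1 / p) with hy
  have hyx : y < x := Real.rpow_lt_rpow_of_exponent_lt (by norm_num)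
    (one_div_lt_one_div_of_lt (by norm_num) hp)
  set D : ℝ := 1 / (x - y) with hD
  have hD0 : 0 < D := one_div_pos.2 (by linarith)
  have hy0 : 0 < y := by positivity
  have hx0 : 0 < x := by positivity
  refine ⟨(D + 1) ^ p, by positivity, fun Y K hY h0 hK m => ?_⟩
  have h := lintegral_dyadicMax_rpow_le_aux (by linarith) hx hy hyx hD m Y K hY h0 hK
  have h' := ENNReal.rpow_le_rpow h hp0.le
  rw [← ENNReal.rpow_mul, one_div_mul_cancel hp0.ne', ENNReal.rpow_one,
    ENNReal.mul_rpow_of_nonneg _ _ hp0.le, ← ENNReal.rpow_mul, one_div_mul_cancel hp0.ne',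
    ENNReal.rpow_one] at h'
  refine h'.trans ?_
  gcongr
  have h2 : 0 ≤ (D + 1) * x ^ m := by positivity
  calc ENNReal.ofReal ((D + 1) * x ^ m - D * y ^ m) ^ p
      ≤ ENNReal.ofReal ((D + 1) * x ^ m) ^ p := by
        gcongr
        have : 0 ≤ D * y ^ m := by positivity
        linarith
    _ = ENNReal.ofReal (((D + 1) * x ^ m) ^ p) := ENNReal.ofReal_rpow_of_nonneg h2 hp0.le
    _ = _ := by
        have h2' : (0 : ℝ) ≤ 2 := by norm_num
        have h3 : (0 : ℝ) ≤ 2 ^ (1 / 2 : ℝ) := by positivity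
        rw [Real.mul_rpow (by positivity) (by positivity), hx, ← Real.rpow_natCast,
          ← Real.rpow_natCast, ← Real.rpow_mul h3, ← Real.rpow_mul h2', ← Real.rpow_mul h2']
        congr 3; ring

theorem le_add_rpow_mul_rpow {p y b : ℝ} (hp : 1 ≤ p) (hy : 0 ≤ y) (hb : 0 < b) :
    y ≤ b + b ^ (1 - p) * y ^ p := by
  rcases le_total y b with h | h
  · have : 0 ≤ b ^ (1 - p) * y ^ p := by positivity
    linarith
  · have hy' : 0 < y := hb.trans_le h
    have h1 : y ^ (1 - p) ≤ b ^ (1 - p) := Real.rpow_le_rpow_of_nonpos hb h (by linarith)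
    have h2 : y ^ (1 - p) * y ^ p = y := by rw [← Real.rpow_add hy']; simp
    have h3 : 0 ≤ y ^ p := by positivity
    nlinarith [mul_le_mul_of_nonneg_right h1 h3]

/-- Brownian scaling in the maximal inequality: the supremum of a process with diffusive
increments and drift `-a` has mean of order `1 / a`. Here `2 < p` is essential, because the
contributions of the blocks `(2 ^ m, 2 ^ (m + 1)]` beyond time `a ^ (-2)` decay like
`2 ^ (m * (1 - p / 2))`. -/
theorem lintegral_iSup_sub_drift_le {p : ℝ} (hp : 2 < p) {K : ℝ} (hK : 0 ≤ K) :
    ∃ C : ℝ, 0 ≤ C ∧ ∀ {Ω : Type*} [MeasurableSpace Ω] {P : Measure Ω} [IsProbabilityMeasure P]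
      (Y : ℕ → Ω → ℝ), (∀ j, Measurable (Y j)) → (∀ ω, Y 0 ω = 0) →
      (∀ i j, i ≤ j →
        ∫⁻ ω, ‖Y j ω - Y i ω‖ₑ ^ p ∂P
          ≤ ENNReal.ofReal K * ((j - i : ℕ) : ℝ≥0∞) ^ (p / 2)) →
      ∀ a : ℝ, 0 < a → a ≤ 1 →
        ∫⁻ ω, ⨆ j : ℕ, ENNReal.ofReal (Y j ω - a * j) ∂P ≤ ENNReal.ofReal (C / a) := by
  obtain ⟨B, hB, hmax⟩ := lintegral_dyadicMax_rpow_le hp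
  have hp0 : 0 < p := by linarith
  set ρ : ℝ := 2 ^ (1 - p / 2) with hρ
  have hρ0 : 0 < ρ := by positivity
  have hρ1 : ρ < 1 := Real.rpow_lt_one_of_one_lt_of_neg (by norm_num) (by linarith)
  set c : ℝ := 2 ^ (p / 2) * 2 ^ (p / 2 - 1) with hc
  have hc0 : 0 < c := by positivity
  refine ⟨1 + K * B + K * B * c * (1 - ρ)⁻¹, ?_, ?_⟩
  · have : 0 ≤ (1 - ρ)⁻¹ := inv_nonneg.2 (by linarith)
    positivity
  intro Ω _ P _ Y hY h0 hinc a ha ha1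
  have hM := hmax Y _ hY h0 hinc
  obtain ⟨m, hm1, hm2⟩ := exists_nat_pow_near (x := a ^ (-2 : ℝ)) (y := 2)
    (Real.one_le_rpow_of_pos_of_le_one_of_nonpos ha ha1 (by norm_num)) (by norm_num)
  -- pointwise bound, block by block
  have hpt : ∀ ω, ⨆ j : ℕ, ENNReal.ofReal (Y j ω - a * j) ≤ ENNReal.ofReal (1 / a)
      + ENNReal.ofReal ((1 / a) ^ (1 - p)) * dyadicMax Y m ω ^ p
      + ∑' i : ℕ, ENNReal.ofReal ((a * 2 ^ (m + i)) ^ (1 - p))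
          * dyadicMax Y (m + i + 1) ω ^ p := by
    intro ω
    refine iSup_le fun j => ?_
    have hpow : ∀ {b : ℝ} {k : ℕ}, 0 < b → j ≤ 2 ^ k →
        ENNReal.ofReal (b ^ (1 - p) * |Y j ω| ^ p)
          ≤ ENNReal.ofReal (b ^ (1 - p)) * dyadicMax Y k ω ^ p := by
      intro b k hb hj
      rw [ENNReal.ofReal_mul (by positivity),
        ← ENNReal.ofReal_rpow_of_nonneg (abs_nonneg _) hp0.le]
      gcongr
      rw [← Real.enorm_eq_ofReal_abs]
      exact enorm_le_dyadicMax Y hj ω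
    rcases le_or_gt j (2 ^ m) with hj | hj
    · refine le_trans ?_ le_self_add
      have hb : (0 : ℝ) < 1 / a := by positivity
      have h1 := le_add_rpow_mul_rpow (p := p) (by linarith) (abs_nonneg (Y j ω)) hb
      have h2 : 0 ≤ a * j := by positivity
      refine le_trans ?_ (add_le_add le_rfl (hpow hb hj))
      rw [← ENNReal.ofReal_add (by positivity) (by positivity)]
      exact ENNReal.ofReal_le_ofReal (by linarith [le_abs_self (Y j ω)])
    · refine le_trans ?_ le_add_self
      have h1 : ∃ i, j ≤ 2 ^ (m + i + 1) := ⟨j, by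
        calc j ≤ 2 ^ j := Nat.lt_two_pow_self.le
          _ ≤ _ := Nat.pow_le_pow_right (by norm_num) (by omega)⟩
      classical
      set i := Nat.find h1 with hi
      have hi1 : j ≤ 2 ^ (m + i + 1) := Nat.find_spec h1
      have hi2 : 2 ^ (m + i) ≤ j := by
        rcases Nat.eq_zero_or_pos i with h | h
        · rw [h]; exact hj.le
        · have := Nat.find_min h1 (m := i - 1) (by omega)
          rw [show m + (i - 1) + 1 = m + i by omega] at this
          omega
      refine le_trans ?_ (ENNReal.le_tsum i)
      have hb : 0 < a * 2 ^ (m + i) := by positivity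
      refine le_trans ?_ (hpow hb hi1)
      have h2 := le_add_rpow_mul_rpow (p := p) (by linarith) (abs_nonneg (Y j ω)) hb
      have h3 : a * 2 ^ (m + i) ≤ a * j := by gcongr; exact_mod_cast hi2
      exact ENNReal.ofReal_le_ofReal (by linarith [le_abs_self (Y j ω)])
  have hmeas : ∀ k, Measurable fun ω => dyadicMax Y k ω ^ p := fun k =>
    (measurable_dyadicMax hY k).pow_const p
  have hfirst : ENNReal.ofReal ((1 / a) ^ (1 - p)) * ∫⁻ ω, dyadicMax Y m ω ^ p ∂P
      ≤ ENNReal.ofReal (K * B / a) := by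
    refine (mul_le_mul_right (hM m) _).trans ?_
    rw [← ENNReal.ofReal_mul hK, ← ENNReal.ofReal_mul (by positivity)]
    refine ENNReal.ofReal_le_ofReal ?_
    have h1 : ((2 : ℝ) ^ m) ^ (p / 2) ≤ a ^ (-p) := by
      calc _ ≤ (a ^ (-2 : ℝ)) ^ (p / 2) := Real.rpow_le_rpow (by positivity) hm1 (by positivity)
        _ = _ := by rw [← Real.rpow_mul ha.le]; congr 1; ring
    have h2 : (1 / a) ^ (1 - p) * a ^ (-p) = 1 / a := by
      rw [one_div, Real.inv_rpow ha.le, ← Real.rpow_neg ha.le, ← Real.rpow_add ha,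
        ← Real.rpow_neg_one]
      congr 1; ring
    calc (1 / a) ^ (1 - p) * (K * (B * ((2 : ℝ) ^ m) ^ (p / 2)))
        ≤ (1 / a) ^ (1 - p) * (K * (B * a ^ (-p))) := by gcongr
      _ = K * B * ((1 / a) ^ (1 - p) * a ^ (-p)) := by ring
      _ = _ := by rw [h2]; ring
  have hterm : ∀ i : ℕ, ENNReal.ofReal ((a * 2 ^ (m + i)) ^ (1 - p))
      * ∫⁻ ω, dyadicMax Y (m + i + 1) ω ^ p ∂P ≤ ENNReal.ofReal (K * B * c / a * ρ ^ i) := by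
    intro i
    refine (mul_le_mul_right (hM _) _).trans ?_
    rw [← ENNReal.ofReal_mul hK, ← ENNReal.ofReal_mul (by positivity)]
    refine ENNReal.ofReal_le_ofReal ?_
    have e1 : (a * 2 ^ (m + i)) ^ (1 - p)
        = a ^ (1 - p) * (((2 : ℝ) ^ m) ^ (1 - p) * ((2 : ℝ) ^ i) ^ (1 - p)) := by
      rw [Real.mul_rpow ha.le (by positivity), pow_add, Real.mul_rpow (by positivity)
        (by positivity)]
    have e2 : ((2 : ℝ) ^ (m + i + 1)) ^ (p / 2)
        = ((2 : ℝ) ^ m) ^ (p / 2) * ((2 : ℝ) ^ i) ^ (p / 2) * 2 ^ (p / 2) := by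
      rw [pow_succ, pow_add, Real.mul_rpow (by positivity) (by positivity),
        Real.mul_rpow (by positivity) (by positivity)]
    have e3 : ((2 : ℝ) ^ m) ^ (1 - p) * ((2 : ℝ) ^ m) ^ (p / 2) = ((2 : ℝ) ^ m) ^ (1 - p / 2) := by
      rw [← Real.rpow_add (by positivity)]; congr 1; ring
    have e4 : ((2 : ℝ) ^ i) ^ (1 - p) * ((2 : ℝ) ^ i) ^ (p / 2) = ρ ^ i := by
      rw [← Real.rpow_add (by positivity), ← Real.rpow_natCast, ← Real.rpow_mul (by norm_num), hρ,
        ← Real.rpow_natCast, ← Real.rpow_mul (by norm_num)]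
      congr 1; ring
    have h5 : ((2 : ℝ) ^ m) ^ (1 - p / 2) ≤ a ^ (p - 2) * 2 ^ (p / 2 - 1) := by
      have h6 : a ^ (-2 : ℝ) / 2 ≤ 2 ^ m := by rw [pow_succ] at hm2; linarith
      calc ((2 : ℝ) ^ m) ^ (1 - p / 2) ≤ (a ^ (-2 : ℝ) / 2) ^ (1 - p / 2) :=
            Real.rpow_le_rpow_of_nonpos (by positivity) h6 (by linarith)
        _ = _ := by
          rw [Real.div_rpow (by positivity) (by norm_num), ← Real.rpow_mul ha.le, div_eq_mul_inv,
            ← Real.rpow_neg (by norm_num)]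
          congr 2 <;> ring
    have h7 : a ^ (1 - p) * a ^ (p - 2) = 1 / a := by
      rw [← Real.rpow_add ha, one_div, ← Real.rpow_neg_one]; congr 1; ring
    calc (a * 2 ^ (m + i)) ^ (1 - p) * (K * (B * ((2 : ℝ) ^ (m + i + 1)) ^ (p / 2)))
        = K * B * 2 ^ (p / 2) * a ^ (1 - p) * (((2 : ℝ) ^ m) ^ (1 - p) * ((2 : ℝ) ^ m) ^ (p / 2))
          * (((2 : ℝ) ^ i) ^ (1 - p) * ((2 : ℝ) ^ i) ^ (p / 2)) := by rw [e1, e2]; ring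
      _ = K * B * 2 ^ (p / 2) * a ^ (1 - p) * ((2 : ℝ) ^ m) ^ (1 - p / 2) * ρ ^ i := by rw [e3, e4]
      _ ≤ K * B * 2 ^ (p / 2) * a ^ (1 - p) * (a ^ (p - 2) * 2 ^ (p / 2 - 1)) * ρ ^ i := by gcongr
      _ = K * B * c * (a ^ (1 - p) * a ^ (p - 2)) * ρ ^ i := by rw [hc]; ring
      _ = _ := by rw [h7]; ring
  have hsum : ∑' i : ℕ, ENNReal.ofReal (K * B * c / a * ρ ^ i)
      = ENNReal.ofReal (K * B * c / a * (1 - ρ)⁻¹) := by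
    rw [← ENNReal.ofReal_tsum_of_nonneg (fun i => by positivity)
      ((summable_geometric_of_lt_one hρ0.le hρ1).mul_left _), tsum_mul_left,
      tsum_geometric_of_lt_one hρ0.le hρ1]
  calc ∫⁻ ω, ⨆ j : ℕ, ENNReal.ofReal (Y j ω - a * j) ∂P
      ≤ _ := lintegral_mono hpt
    _ = ENNReal.ofReal (1 / a) + ENNReal.ofReal ((1 / a) ^ (1 - p)) * ∫⁻ ω, dyadicMax Y m ω ^ p ∂P
        + ∑' i : ℕ, ENNReal.ofReal ((a * 2 ^ (m + i)) ^ (1 - p))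
          * ∫⁻ ω, dyadicMax Y (m + i + 1) ω ^ p ∂P := by
      rw [lintegral_add_left (by fun_prop), lintegral_add_left measurable_const,
        lintegral_const_mul _ (hmeas _), lintegral_tsum fun i => ((hmeas _).const_mul _).aemeasurable]
      simp only [lintegral_const, measure_univ, mul_one]
      congr 1
      exact tsum_congr fun i => lintegral_const_mul _ (hmeas _)
    _ ≤ ENNReal.ofReal (1 / a) + ENNReal.ofReal (K * B / a)
        + ENNReal.ofReal (K * B * c / a * (1 - ρ)⁻¹) := by
      rw [← hsum]
      exact add_le_add (add_le_add le_rfl hfirst) (ENNReal.tsum_le_tsum hterm)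
    _ = _ := by
      have : 0 < 1 - ρ := by linarith
      rw [← ENNReal.ofReal_add (by positivity) (by positivity),
        ← ENNReal.ofReal_add (by positivity) (by positivity)]
      congr 1; ring

/-! ### Random walks with nonnegative steps of mean one -/

/-- A law on `[0, ∞)` with mean `1` and a finite moment of order `p`. -/
structure IsUnitMeanLaw (F : Measure ℝ) (p : ℝ) : Prop where
  nonneg : F (Iio 0) = 0
  mean_eq_one : ∫ x, x ∂F = 1
  moment : Integrable (fun x : ℝ => |x| ^ p) F

/-- The variables `x 0, x 1, …` are independent with common law `F`. -/
structure IsIIDSeq {Ω : Type*} [MeasurableSpace Ω] (P : Measure Ω) (F : Measure ℝ)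
    (x : ℕ → Ω → ℝ) : Prop where
  measurable : ∀ n, Measurable (x n)
  law : ∀ n, P.map (x n) = F
  indep : iIndepFun x P

section

variable {Ω : Type*} [MeasurableSpace Ω] {P : Measure Ω} {F : Measure ℝ} {x : ℕ → Ω → ℝ}

theorem IsIIDSeq.integral_comp (h : IsIIDSeq P F x) (n : ℕ) {f : ℝ → ℝ} (hf : Measurable f) :
    ∫ ω, f (x n ω) ∂P = ∫ y, f y ∂F := by
  rw [← h.law n, integral_map (h.measurable n).aemeasurable hf.aestronglyMeasurable]

theorem IsIIDSeq.integrable_comp (h : IsIIDSeq P F x) (n : ℕ) {f : ℝ → ℝ} (hf : Measurable f)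
    (hi : Integrable f F) : Integrable (fun ω => f (x n ω)) P := by
  rw [← h.law n] at hi
  exact (integrable_map_measure hf.aestronglyMeasurable (h.measurable n).aemeasurable).1 hi

theorem IsIIDSeq.ae_mem (h : IsIIDSeq P F x) {s : Set ℝ} (hs : MeasurableSet s)
    (hF : F sᶜ = 0) : ∀ᵐ ω ∂P, ∀ n, x n ω ∈ s := by
  refine ae_all_iff.2 fun n => ?_
  have : P (x n ⁻¹' sᶜ) = 0 := by
    rw [← Measure.map_apply (h.measurable n) hs.compl, h.law n, hF]
  exact this

theorem IsIIDSeq.ae_nonneg (h : IsIIDSeq P F x) (hF : F (Iio 0) = 0) :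
    ∀ᵐ ω ∂P, ∀ n, 0 ≤ x n ω :=
  h.ae_mem (s := Ici 0) measurableSet_Ici (by simpa using hF)

theorem IsIIDSeq.identDistrib_sum_shift (h : IsIIDSeq P F x) (m k : ℕ) :
    IdentDistrib (fun ω => ∑ i ∈ Finset.range k, x (m + i) ω)
      (fun ω => ∑ i ∈ Finset.range k, x i ω) P P := by
  have h1 : IdentDistrib (fun ω i => x (m + i) ω) (fun ω i => x i ω) P P :=
    IdentDistrib.pi
      (fun i => ⟨(h.measurable _).aemeasurable, (h.measurable _).aemeasurable,
        (h.law _).trans (h.law _).symm⟩)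
      (h.indep.precomp (add_right_injective m)) h.indep
  exact h1.comp (u := fun y : ℕ → ℝ => ∑ i ∈ Finset.range k, y i) (by fun_prop)

end

section

variable {F : Measure ℝ} [IsProbabilityMeasure F] {p : ℝ}

theorem IsUnitMeanLaw.integrable_id (hF : IsUnitMeanLaw F p) (hp : 1 ≤ p) :
    Integrable (fun y : ℝ => y) F :=
  integrable_of_integrable_abs_rpow measurable_id hp hF.moment

theorem IsUnitMeanLaw.mono (hF : IsUnitMeanLaw F p) {q : ℝ} (hq : 0 ≤ q) (hqp : q ≤ p) :
    IsUnitMeanLaw F q :=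
  ⟨hF.nonneg, hF.mean_eq_one, integrable_abs_rpow_of_le measurable_id hq hqp hF.moment⟩

theorem integrable_abs_sub_const_rpow {Ω : Type*} [MeasurableSpace Ω] {P : Measure Ω}
    [IsFiniteMeasure P] {X : Ω → ℝ} (hX : Measurable X) (hp : 1 ≤ p)
    (h : Integrable (fun ω => |X ω| ^ p) P) (c : ℝ) :
    Integrable (fun ω => |X ω - c| ^ p) P := by
  have h1 : MemLp X (ENNReal.ofReal p) P := by
    rw [← integrable_norm_rpow_iff hX.aestronglyMeasurable (by simp; linarith) (by simp),
      ENNReal.toReal_ofReal (by linarith)]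
    exact h
  have h2 : MemLp (fun ω => X ω - c) (ENNReal.ofReal p) P := h1.sub (memLp_const c)
  rw [← integrable_norm_rpow_iff (hX.sub_const c).aestronglyMeasurable (by simp; linarith)
    (by simp), ENNReal.toReal_ofReal (by linarith)] at h2
  exact h2

/-- The centred walk is diffusive in `L^p`. -/
theorem IsUnitMeanLaw.exists_walk_moment_le (hF : IsUnitMeanLaw F p) (hp : 2 ≤ p) (hp3 : p ≤ 3) :
    ∃ C : ℝ, 0 ≤ C ∧ ∀ {Ω : Type*} [MeasurableSpace Ω] {P : Measure Ω} [IsProbabilityMeasure P]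
      {x : ℕ → Ω → ℝ}, IsIIDSeq P F x → ∀ s : Finset ℕ,
        Integrable (fun ω => |∑ i ∈ s, (x i ω - 1)| ^ p) P ∧
          ∫ ω, |∑ i ∈ s, (x i ω - 1)| ^ p ∂P ≤ C * (s.card : ℝ) ^ (p / 2) := by
  set a : ℝ := (∫ y, (y - 1) ^ 2 ∂F) + 1
  set b : ℝ := ∫ y, |y - 1| ^ p ∂F
  have hb : 0 ≤ b := integral_nonneg fun y => by positivity
  have ha : 0 < a := by
    have : 0 ≤ ∫ y, (y - 1) ^ 2 ∂F := integral_nonneg fun y => sq_nonneg _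
    positivity
  refine ⟨110 * (a ^ (p / 2) + b), by positivity, fun {Ω} _ {P} _ {x} hx s => ?_⟩
  have hF' := integrable_abs_sub_const_rpow measurable_id (by linarith) hF.moment 1
  have hm1 : Measurable fun y : ℝ => |y - 1| ^ p := by fun_prop
  have hm2 : Measurable fun y : ℝ => (y - 1) ^ 2 := by fun_prop
  have hm3 : Measurable fun y : ℝ => y - 1 := by fun_prop
  have h := integral_abs_sum_rpow_le (P := P) hp hp3 (Y := fun i ω => x i ω - 1)
    (fun i => (hx.measurable i).sub_const 1) (hx.indep.comp (fun _ y => y - 1) fun _ => hm3)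
    (fun i => by
      rw [hx.integral_comp i hm3, integral_sub (hF.integrable_id (by linarith))
        (integrable_const _), hF.mean_eq_one]; simp)
    (fun i => hx.integrable_comp i hm1 hF') ha (a := a) (b := b)
    (fun i => by rw [hx.integral_comp i hm2]; simp [a])
    (fun i => by rw [hx.integral_comp i hm1]) s
  refine ⟨h.1, h.2.trans ?_⟩
  have h1 : (s.card : ℝ) ≤ (s.card : ℝ) ^ (p / 2) := by
    rcases Nat.eq_zero_or_pos s.card with h0 | h0
    · rw [h0]; simp [Real.zero_rpow (show p / 2 ≠ 0 by linarith)]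
    · have : (1 : ℝ) ≤ s.card := by exact_mod_cast h0
      simpa using Real.rpow_le_rpow_of_exponent_le this (show (1 : ℝ) ≤ p / 2 by linarith)
  rw [Real.mul_rpow (by positivity) ha.le]
  nlinarith [mul_le_mul_of_nonneg_right h1 hb]

/-- Chernoff bound for the lower tail. Since the steps are nonnegative, a second moment suffices:
`exp (-y) ≤ 1 - y + y ^ 2 / 2` for `0 ≤ y`. -/
theorem IsUnitMeanLaw.exists_measure_walk_le (hF : IsUnitMeanLaw F p) (hp : 2 ≤ p) :
    ∃ r : ℝ, 0 < r ∧ r < 1 ∧ ∀ {Ω : Type*} [MeasurableSpace Ω] {P : Measure Ω}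
      [IsProbabilityMeasure P] {x : ℕ → Ω → ℝ}, IsIIDSeq P F x → ∀ k : ℕ,
        P {ω | ∑ i ∈ Finset.range k, x i ω ≤ (k : ℝ) / 2} ≤ ENNReal.ofReal (r ^ k) := by
  have hF2 : Integrable (fun y : ℝ => y ^ 2) F :=
    integrable_sq_of_integrable_abs_rpow measurable_id hp hF.moment
  set m : ℝ := (∫ y, y ^ 2 ∂F) + 1 with hm
  have hm0 : 0 < m := by
    have : 0 ≤ ∫ y, y ^ 2 ∂F := integral_nonneg fun y => sq_nonneg _
    positivity
  set θ : ℝ := 1 / (2 * m) with hθ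
  have hθ0 : 0 < θ := by positivity
  refine ⟨Real.exp (-(θ / 4)), Real.exp_pos _, Real.exp_lt_one_iff.2 (by linarith), ?_⟩
  intro Ω _ P _ x hx k
  have hexp : Integrable (fun y : ℝ => Real.exp (-θ * y)) F := by
    refine Integrable.mono' (integrable_const (1 : ℝ)) (by fun_prop) ?_
    have : ∀ᵐ y ∂F, 0 ≤ y := by
      have : F (Ici 0)ᶜ = 0 := by simpa using hF.nonneg
      exact this
    filter_upwards [this] with y hy
    rw [Real.norm_of_nonneg (Real.exp_pos _).le]
    exact Real.exp_le_one_iff.2 (by nlinarith)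
  have hmgf : ∀ i, mgf (x i) P (-θ) ≤ Real.exp (-θ + θ ^ 2 * m / 2) := by
    intro i
    have hmeas : Measurable fun y : ℝ => Real.exp (-θ * y) := by fun_prop
    have h1 : mgf (x i) P (-θ) = ∫ y, Real.exp (-θ * y) ∂F := by
      rw [mgf, ← hx.integral_comp i hmeas]
    have hid := hF.integrable_id (by linarith)
    have h2 : ∫ y, Real.exp (-θ * y) ∂F ≤ ∫ y, (1 - θ * y + θ ^ 2 / 2 * y ^ 2) ∂F := by
      refine integral_mono_ae hexp
        (((integrable_const _).sub (hid.const_mul _)).add (hF2.const_mul _)) ?_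
      have : ∀ᵐ y ∂F, 0 ≤ y := by
        have : F (Ici 0)ᶜ = 0 := by simpa using hF.nonneg
        exact this
      filter_upwards [this] with y hy
      have hz : 0 ≤ θ * y := by positivity
      have h3 : Real.exp (-(θ * y)) ≤ 1 - θ * y + (θ * y) ^ 2 / 2 := by
        -- compare with `exp z ≥ 1 + z + z ^ 2 / 2`
        set z := θ * y
        have h4 := Real.quadratic_le_exp_of_nonneg hz
        rw [Real.exp_neg]
        refine inv_le_of_inv_le₀ (by nlinarith [sq_nonneg (z - 1)]) ?_
        refine le_trans ?_ h4
        rw [inv_le_iff_one_le_mul₀ (by nlinarith [sq_nonneg (z - 1)])]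
        nlinarith [sq_nonneg (z ^ 2)]
      have h5 : -θ * y = -(θ * y) := by ring
      rw [h5]
      refine h3.trans_eq (by ring)
    have h3 : ∫ y, (1 - θ * y + θ ^ 2 / 2 * y ^ 2) ∂F = 1 - θ + θ ^ 2 / 2 * (m - 1) := by
      have i1 : Integrable (fun y : ℝ => 1 - θ * y) F :=
        (integrable_const _).sub (hid.const_mul _)
      rw [integral_add i1 (hF2.const_mul _), integral_sub (integrable_const _) (hid.const_mul _),
        integral_const_mul, integral_const_mul, hF.mean_eq_one, hm]
      simp
    rw [h1]
    refine (h2.trans_eq h3).trans ?_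
    have := Real.add_one_le_exp (-θ + θ ^ 2 * m / 2)
    nlinarith [sq_nonneg θ]
  have hsum : mgf (∑ i ∈ Finset.range k, x i) P (-θ) ≤ Real.exp (-θ + θ ^ 2 * m / 2) ^ k := by
    rw [hx.indep.mgf_sum hx.measurable]
    refine (Finset.prod_le_prod (fun i _ => mgf_nonneg) fun i _ => hmgf i).trans_eq ?_
    simp
  have hint : Integrable (fun ω => Real.exp (-θ * (∑ i ∈ Finset.range k, x i) ω)) P :=
    hx.indep.integrable_exp_mul_sum hx.measurable fun i _ =>
      hx.integrable_comp i (f := fun y => Real.exp (-θ * y)) (by fun_prop) hexp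
  have hch := measure_le_le_exp_mul_mgf (k / 2 : ℝ) (by linarith : -θ ≤ 0) hint
  have hreal : P.real {ω | (∑ i ∈ Finset.range k, x i) ω ≤ (k : ℝ) / 2}
      ≤ Real.exp (-(θ / 4)) ^ k := by
    refine hch.trans ((mul_le_mul_of_nonneg_left hsum (Real.exp_pos _).le).trans_eq ?_)
    rw [← Real.exp_nat_mul, ← Real.exp_nat_mul, ← Real.exp_add]
    congr 1
    have : θ * m = 1 / 2 := by rw [hθ]; field_simp
    linear_combination (k * θ / 2) * this
  simp only [Finset.sum_apply] at hreal
  rw [← ENNReal.ofReal_toReal (measure_ne_top P _)]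
  exact ENNReal.ofReal_le_ofReal hreal

/-- Borel–Cantelli for the Chernoff bound. -/
theorem IsIIDSeq.ae_eventually_half_lt_walk {Ω : Type*} [MeasurableSpace Ω] {P : Measure Ω}
    [IsProbabilityMeasure P] {x : ℕ → Ω → ℝ} (hx : IsIIDSeq P F x) (hF : IsUnitMeanLaw F p)
    (hp : 2 ≤ p) :
    ∀ᵐ ω ∂P, ∀ᶠ k : ℕ in Filter.atTop, (k : ℝ) / 2 < ∑ i ∈ Finset.range k, x i ω := by
  obtain ⟨r, hr0, hr1, h⟩ := hF.exists_measure_walk_le hp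
  have hs : ∑' k : ℕ, P {ω | ∑ i ∈ Finset.range k, x i ω ≤ (k : ℝ) / 2} ≠ ∞ := by
    refine ne_top_of_le_ne_top ?_ (ENNReal.tsum_le_tsum fun k => h hx k)
    rw [← ENNReal.ofReal_tsum_of_nonneg (fun k => by positivity)
      (summable_geometric_of_lt_one hr0.le hr1)]
    exact ENNReal.ofReal_ne_top
  filter_upwards [ae_eventually_notMem hs] with ω hω
  filter_upwards [hω] with k hk
  simpa using hk

end

/-- Jensen's inequality for the positive part and an independent centred summand. -/
theorem integral_max_zero_le_of_indepFun {Ω : Type*} [MeasurableSpace Ω] {P : Measure Ω}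
    {X Y : Ω → ℝ} (hX : Measurable X) (hY : Measurable Y)
    (hXi : Integrable X P) (hYi : Integrable Y P) (hXY : IndepFun X Y P)
    (hY0 : ∫ ω, Y ω ∂P = 0) :
    ∫ ω, max (X ω) 0 ∂P ≤ ∫ ω, max (X ω + Y ω) 0 ∂P := by
  set φ : ℝ → ℝ := (Ioi (0 : ℝ)).indicator 1 with hφ
  have hφm : Measurable φ := measurable_one.indicator measurableSet_Ioi
  have hc := hXY.comp hφm measurable_id
  have hb : ∀ ω, |φ (X ω)| ≤ 1 := fun ω => by
    by_cases h : 0 < X ω <;> simp [hφ, h]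
  have hi : Integrable (fun ω => φ (X ω) * Y ω) P := by
    refine hYi.mono ((hφm.comp hX).mul hY).aestronglyMeasurable (ae_of_all _ fun ω => ?_)
    rw [norm_mul]
    exact mul_le_of_le_one_left (norm_nonneg _) (hb ω)
  have hz : ∫ ω, φ (X ω) * Y ω ∂P = 0 := by
    refine (hc.integral_mul_eq_mul_integral (hφm.comp hX).aestronglyMeasurable
      hY.aestronglyMeasurable).trans ?_
    simp [hY0]
  have hXp : Integrable (fun ω => max (X ω) 0) P := hXi.pos_part
  have hXYp : Integrable (fun ω => max (X ω + Y ω) 0) P := (hXi.add hYi).pos_part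
  calc ∫ ω, max (X ω) 0 ∂P = ∫ ω, (max (X ω) 0 + φ (X ω) * Y ω) ∂P := by
        rw [integral_add hXp hi, hz, add_zero]
    _ ≤ _ := by
        refine integral_mono (hXp.add hi) hXYp fun ω => ?_
        by_cases h : 0 < X ω
        · simp [hφ, h, h.le]
        · simp [hφ, h, not_lt.1 h]

/-! ### Paths of renewal counting processes -/

/-- Paths along which the epochs are nondecreasing and tend to infinity. -/
structure IsRegularPath (x : ℕ → ℝ) : Prop where
  nonneg : ∀ n, 0 ≤ x n
  finite : ∀ t : ℝ, {n : ℕ | ∑ i ∈ Finset.range (n + 1), x i ≤ t}.Finite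

theorem lt_ncard_iff_mem_of_isLowerSet {s : Set ℕ} (hs : s.Finite) (hl : IsLowerSet s) (n : ℕ) :
    n < s.ncard ↔ n ∈ s := by
  classical
  have hex : ∃ m, m ∉ s := hs.exists_notMem
  have hsm : s = Iio (Nat.find hex) := by
    ext k
    constructor
    · intro hk
      by_contra h
      exact Nat.find_spec hex (hl (not_lt.1 h) hk)
    · intro hk
      by_contra h
      exact Nat.find_min hex hk h
  rw [hsm]
  simp [Set.ncard_eq_toFinset_card']

theorem isLowerSet_epochs {x : ℕ → ℝ} (hx : ∀ n, 0 ≤ x n) (t : ℝ) :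
    IsLowerSet {n : ℕ | ∑ i ∈ Finset.range (n + 1), x i ≤ t} := by
  intro a b hba ha
  refine le_trans ?_ (show _ ≤ t from ha)
  exact Finset.sum_le_sum_of_subset_of_nonneg
    (Finset.range_subset_range.2 (by omega)) fun i _ _ => hx i

/-- The Galois connection between epochs and counts. -/
theorem IsRegularPath.lt_renewalCount_iff {Ω : Type*} {v : ℕ → Ω → ℝ} {ω : Ω}
    (h : IsRegularPath fun n => v n ω) (t : ℝ≥0) (n : ℕ) :
    n < renewalCount v t ω ↔ ∑ i ∈ Finset.range (n + 1), v i ω ≤ t :=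
  lt_ncard_iff_mem_of_isLowerSet (h.finite t) (isLowerSet_epochs h.nonneg t) n

theorem IsRegularPath.renewalCount_mono {Ω : Type*} {v : ℕ → Ω → ℝ} {ω : Ω}
    (h : IsRegularPath fun n => v n ω) {s t : ℝ≥0} (hst : s ≤ t) :
    renewalCount v s ω ≤ renewalCount v t ω := by
  by_contra! hlt
  have h1 := (h.lt_renewalCount_iff s _).1 hlt
  exact lt_irrefl _ ((h.lt_renewalCount_iff t _).2 (h1.trans (by exact_mod_cast hst)))

theorem isRegularPath_of_eventually {x : ℕ → ℝ} (hx : ∀ n, 0 ≤ x n) {c : ℝ} (hc : 0 < c)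
    (h : ∀ᶠ k : ℕ in Filter.atTop, c * k < ∑ i ∈ Finset.range k, x (i + 1)) :
    IsRegularPath x := by
  refine ⟨hx, fun t => ?_⟩
  have h1 : ∀ᶠ k : ℕ in Filter.atTop, t ≤ c * k :=
    (tendsto_natCast_atTop_atTop.const_mul_atTop hc).eventually_ge_atTop t
  obtain ⟨K, hK⟩ := Filter.eventually_atTop.1 (h.and h1)
  refine (finite_Iio K).subset fun n hn => ?_
  by_contra hn'
  obtain ⟨h2, h3⟩ := hK n (not_lt.1 hn')
  have h4 : ∑ i ∈ Finset.range (n + 1), x i ≤ t := hn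
  rw [Finset.sum_range_succ'] at h4
  linarith [hx 0]

theorem IsRegularPath.renewalCount_zero {Ω : Type*} {v : ℕ → Ω → ℝ} {ω : Ω}
    (h : IsRegularPath fun n => v n ω) (h0 : 0 < v 0 ω) : renewalCount v 0 ω = 0 := by
  by_contra hne
  have := (h.lt_renewalCount_iff 0 0).1 (Nat.pos_of_ne_zero hne)
  simp at this
  linarith

theorem IsRegularPath.eventually_renewalCount_eq {Ω : Type*} {v : ℕ → Ω → ℝ} {ω : Ω}
    (h : IsRegularPath fun n => v n ω) (t : ℝ≥0) :
    ∀ᶠ t' in nhdsWithin t (Ioi t), renewalCount v t' ω = renewalCount v t ω := by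
  set m := renewalCount v t ω with hm
  have h1 : (t : ℝ) < ∑ i ∈ Finset.range (m + 1), v i ω := by
    by_contra hle
    exact lt_irrefl m ((h.lt_renewalCount_iff t m).2 (not_lt.1 hle))
  have h2 : t < (∑ i ∈ Finset.range (m + 1), v i ω).toNNReal := Real.lt_toNNReal_iff_coe_lt.2 h1
  filter_upwards [Ioo_mem_nhdsGT h2] with t' ht'
  refine le_antisymm ?_ (h.renewalCount_mono ht'.1.le)
  by_contra! hlt
  have h4 := (h.lt_renewalCount_iff t' m).1 hlt
  linarith [Real.lt_toNNReal_iff_coe_lt.1 ht'.2]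

theorem measurable_renewalCount {Ω : Type*} [MeasurableSpace Ω] {v : ℕ → Ω → ℝ}
    (hv : ∀ n, Measurable (v n)) (t : ℝ≥0) :
    Measurable fun ω => (renewalCount v t ω : ℝ) := by
  have h : (fun ω => (renewalCount v t ω : ℝ)) = fun ω =>
      (∑' n : ℕ, {ω | ∑ i ∈ Finset.range (n + 1), v i ω ≤ (t : ℝ)}.indicator
        (fun _ => (1 : ℝ≥0∞)) ω).toReal := by
    ext ω
    set s : Set ℕ := {n : ℕ | ∑ i ∈ Finset.range (n + 1), v i ω ≤ (t : ℝ)} with hs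
    have h1 : ∀ n : ℕ, {ω | ∑ i ∈ Finset.range (n + 1), v i ω ≤ (t : ℝ)}.indicator
        (fun _ => (1 : ℝ≥0∞)) ω = s.indicator (fun _ => 1) n := fun n => by
      simp [indicator, hs]
    simp only [h1]
    rw [← tsum_subtype, ENNReal.tsum_set_one, renewalCount, ← hs, Set.ncard]
    rcases eq_or_ne s.encard ⊤ with h2 | h2
    · simp [h2]
    · lift s.encard to ℕ using h2 with m
      simp
  rw [h]
  refine (Measurable.tsum fun n => ?_).ennreal_toReal
  exact measurable_const.indicator
    (measurableSet_le (Finset.measurable_sum _ fun i _ => hv i) measurable_const)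

theorem IsRegularPath.tsum_pairs {Ω : Type*} {v : ℕ → Ω → ℝ} {ω : Ω}
    (hω : IsRegularPath fun n => v n ω)
    (s t : ℝ≥0) (k : ℕ) :
    ∑' n : ℕ, {ω | (s : ℝ) < ∑ i ∈ Finset.range (n + 1), v i ω ∧
        ∑ i ∈ Finset.range (n + k + 1), v i ω ≤ t}.indicator (fun _ => (1 : ℝ≥0∞)) ω
      = ENNReal.ofReal ((renewalCount v t ω : ℝ) - renewalCount v s ω - k) := by
  have h1 : ∀ n : ℕ, {ω | (s : ℝ) < ∑ i ∈ Finset.range (n + 1), v i ω ∧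
        ∑ i ∈ Finset.range (n + k + 1), v i ω ≤ t}.indicator (fun _ => (1 : ℝ≥0∞)) ω
      = if n ∈ Finset.Ico (renewalCount v s ω) (renewalCount v t ω - k) then 1 else 0 := by
    intro n
    simp only [indicator, mem_ofPred_eq, Finset.mem_Ico]
    congr 1
    rw [eq_iff_iff, ← hω.lt_renewalCount_iff t, ← not_le, ← hω.lt_renewalCount_iff s]
    omega
  simp only [h1]
  rw [tsum_eq_sum (s := Finset.Ico (renewalCount v s ω) (renewalCount v t ω - k))
    fun n hn => if_neg hn, Finset.sum_congr rfl fun n hn => if_pos hn]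
  simp only [Finset.sum_const, Nat.card_Ico, nsmul_eq_mul, mul_one]
  rw [← ENNReal.ofReal_natCast]
  rcases le_total (renewalCount v s ω + k) (renewalCount v t ω) with h2 | h2
  · congr 1
    rw [show renewalCount v t ω - k - renewalCount v s ω
      = renewalCount v t ω - (renewalCount v s ω + k) by omega, Nat.cast_sub h2]
    push_cast; ring
  · have h3 : (renewalCount v t ω : ℝ) ≤ renewalCount v s ω + k := by exact_mod_cast h2
    rw [ENNReal.ofReal_of_nonpos (by linarith : (renewalCount v t ω : ℝ) - _ - k ≤ 0)]
    rw [show renewalCount v t ω - k - renewalCount v s ω = 0 by omega]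
    simp

/-! ### Stationary renewal processes -/

/-- Integration by parts against the equilibrium law: `P(u ≤ a) + E (a - v)⁺ = a⁺`. -/
theorem equilibriumLaw_Iic_add_lintegral {F : Measure ℝ} [IsProbabilityMeasure F]
    (hF : F (Iio 0) = 0) (hm : ∫ y, y ∂F = 1) (a : ℝ) :
    equilibriumLaw F (Iic a) + ∫⁻ y, ENNReal.ofReal (a - y) ∂F = ENNReal.ofReal a := by
  have h1 : equilibriumLaw F (Iic a) = ∫⁻ x in Icc 0 a, F (Ioi x) := by
    rw [equilibriumLaw, withDensity_apply _ measurableSet_Iic, Measure.restrict_restrict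
      measurableSet_Iic, inter_comm, Ici_inter_Iic, hm]
    refine lintegral_congr fun x => ?_
    rw [div_one, cdf_eq_real, ← compl_Iic, prob_compl_eq_one_sub
      measurableSet_Iic, Measure.real, ENNReal.ofReal_sub _ ENNReal.toReal_nonneg,
      ENNReal.ofReal_toReal (measure_ne_top _ _), ENNReal.ofReal_one]
  have hae : ∀ᵐ y ∂F, 0 ≤ y := by
    have : F (Ici 0)ᶜ = 0 := by simpa using hF
    exact this
  have h2 : ∫⁻ y, ENNReal.ofReal (a - y) ∂F = ∫⁻ x in Icc 0 a, F (Iic x) := by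
    have hS : MeasurableSet {q : ℝ × ℝ | q.1 ≤ q.2} := measurableSet_le measurable_fst measurable_snd
    have e1 := Measure.prod_apply (μ := F) (ν := volume.restrict (Icc 0 a)) hS
    have e2 := Measure.prod_apply_symm (μ := F) (ν := volume.restrict (Icc 0 a)) hS
    rw [e1] at e2
    calc ∫⁻ y, ENNReal.ofReal (a - y) ∂F
        = ∫⁻ y, (volume.restrict (Icc 0 a)) (Prod.mk y ⁻¹' {q : ℝ × ℝ | q.1 ≤ q.2}) ∂F := by
          refine lintegral_congr_ae ?_
          filter_upwards [hae] with y hy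
          have : Prod.mk y ⁻¹' {q : ℝ × ℝ | q.1 ≤ q.2} = Ici y := by ext; simp
          rw [this, Measure.restrict_apply measurableSet_Ici]
          have : Ici y ∩ Icc 0 a = Icc y a := by
            ext z; simp only [mem_inter_iff, mem_Ici, mem_Icc]
            exact ⟨fun h => ⟨h.1, h.2.2⟩, fun h => ⟨h.1, hy.trans h.1, h.2⟩⟩
          rw [this, Real.volume_Icc]
      _ = _ := e2
      _ = _ := lintegral_congr fun x => by congr 1
  rw [h1, h2, ← lintegral_add_right]
  · have : ∀ x : ℝ, F (Ioi x) + F (Iic x) = 1 := fun x => by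
      rw [← compl_Iic, add_comm, measure_add_measure_compl measurableSet_Iic, measure_univ]
    simp [this]
  · have : Monotone fun x => F (Iic x) := fun x y hxy => measure_mono (Iic_subset_Iic.2 hxy)
    exact this.measurable

section

variable {Ω : Type*} [MeasurableSpace Ω] {P : Measure Ω}

theorem indepFun_blocks {v : ℕ → Ω → ℝ} (hv : ∀ n, Measurable (v n)) (h : iIndepFun v P)
    {s t : Finset ℕ} (hst : Disjoint s t) :
    IndepFun (fun ω => ∑ i ∈ s, v i ω) (fun ω => ∑ i ∈ t, v i ω) P := by
  have h1 := (h.indepFun_finset s t hst hv).comp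
    (φ := fun y : s → ℝ => ∑ i, y i) (ψ := fun y : t → ℝ => ∑ i, y i) (by fun_prop) (by fun_prop)
  convert h1 using 1 <;>
  · ext ω
    simp only [Function.comp]
    exact (Finset.sum_coe_sort _ (fun i => v i ω)).symm

theorem lintegral_comp_of_indepFun [IsProbabilityMeasure P] {X Y : Ω → ℝ} (hX : Measurable X)
    (hY : Measurable Y) (h : IndepFun X Y P) {f : ℝ × ℝ → ℝ≥0∞} (hf : Measurable f) :
    ∫⁻ ω, f (X ω, Y ω) ∂P = ∫⁻ x, ∫⁻ y, f (x, y) ∂(P.map Y) ∂(P.map X) := by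
  have h1 := (indepFun_iff_map_prod_eq_prod_map_map hX.aemeasurable hY.aemeasurable).1 h
  have := Measure.isProbabilityMeasure_map (μ := P) hX.aemeasurable
  have := Measure.isProbabilityMeasure_map (μ := P) hY.aemeasurable
  rw [← lintegral_prod _ hf.aemeasurable, ← h1, lintegral_map hf (hX.prodMk hY)]

variable {F : Measure ℝ} {p : ℝ} {v : ℕ → Ω → ℝ}

theorem IsStationaryRenewalSeq.isIIDSeq (h : IsStationaryRenewalSeq P F v) :
    IsIIDSeq P F fun n => v (n + 1) :=
  ⟨fun n => h.measurable _, fun n => h.law_renewal _ (by omega),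
    h.indep.precomp (add_left_injective 1)⟩

theorem IsStationaryRenewalSeq.ae_delay_pos (h : IsStationaryRenewalSeq P F v) :
    ∀ᵐ ω ∂P, 0 < v 0 ω := by
  have h1 : equilibriumLaw F (Iic 0) = 0 := by
    rw [equilibriumLaw, withDensity_apply _ measurableSet_Iic,
      Measure.restrict_restrict measurableSet_Iic, inter_comm, Ici_inter_Iic, Icc_self]
    simp
  rw [← h.law_delay, Measure.map_apply (h.measurable 0) measurableSet_Iic] at h1
  filter_upwards [measure_eq_zero_iff_ae_notMem.1 h1] with ω hω
  simpa using hω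

theorem IsStationaryRenewalSeq.ae_isRegularPath [IsProbabilityMeasure P]
    [IsProbabilityMeasure F] (h : IsStationaryRenewalSeq P F v)
    (hF : IsUnitMeanLaw F p) (hp : 2 ≤ p) : ∀ᵐ ω ∂P, IsRegularPath fun n => v n ω := by
  filter_upwards [h.ae_delay_pos, h.isIIDSeq.ae_nonneg hF.nonneg,
    h.isIIDSeq.ae_eventually_half_lt_walk hF hp] with ω h0 h1 h2
  refine isRegularPath_of_eventually (fun n => ?_) (c := 1 / 2) (by norm_num) ?_
  · cases n with
    | zero => exact h0.le
    | succ n => exact h1 n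
  · filter_upwards [h2] with k hk
    linarith

/-- One step of the telescoping sum behind the renewal equation. -/
theorem IsStationaryRenewalSeq.measure_epoch_le_add [IsProbabilityMeasure P]
    [IsProbabilityMeasure F] (h : IsStationaryRenewalSeq P F v)
    (hF : IsUnitMeanLaw F p) (n : ℕ) (x : ℝ) :
    P {ω | ∑ i ∈ Finset.range (n + 1), v i ω ≤ x}
      + ∫⁻ ω, ENNReal.ofReal (x - ∑ i ∈ Finset.range (n + 1), v (i + 1) ω) ∂P
      = ∫⁻ ω, ENNReal.ofReal (x - ∑ i ∈ Finset.range n, v (i + 1) ω) ∂P := by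
  set V : Ω → ℝ := fun ω => ∑ i ∈ Finset.range n, v (i + 1) ω with hV
  have hvm := h.measurable
  have hVm : Measurable V := Finset.measurable_sum _ fun i _ => hvm _
  have hV0 : IndepFun V (v 0) P := by
    have := indepFun_blocks hvm h.indep (s := Finset.Ico 1 (n + 1)) (t := {0})
      (by simp)
    convert this using 1
    · ext ω; simp [hV, Finset.sum_Ico_eq_sum_range, add_comm]
    · ext ω; simp
  have hVn : IndepFun V (v (n + 1)) P := by
    have := indepFun_blocks hvm h.indep (s := Finset.Ico 1 (n + 1)) (t := {n + 1})
      (by simp)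
    convert this using 1
    · ext ω; simp [hV, Finset.sum_Ico_eq_sum_range, add_comm]
    · ext ω; simp
  have e1 : P {ω | ∑ i ∈ Finset.range (n + 1), v i ω ≤ x}
      = ∫⁻ w, equilibriumLaw F (Iic (x - w)) ∂(P.map V) := by
    have hS : MeasurableSet {q : ℝ × ℝ | q.1 + q.2 ≤ x} :=
      measurableSet_le (by fun_prop) measurable_const
    have := lintegral_comp_of_indepFun hVm (hvm 0) hV0
      (f := {q : ℝ × ℝ | q.1 + q.2 ≤ x}.indicator 1) (measurable_one.indicator hS)
    rw [h.law_delay] at this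
    calc _ = ∫⁻ ω, {q : ℝ × ℝ | q.1 + q.2 ≤ x}.indicator 1 (V ω, v 0 ω) ∂P := by
          have hS' : MeasurableSet {ω | V ω + v 0 ω ≤ x} :=
            measurableSet_le (hVm.add (hvm 0)) measurable_const
          rw [show {ω | ∑ i ∈ Finset.range (n + 1), v i ω ≤ x} = {ω | V ω + v 0 ω ≤ x} by
            ext ω; simp only [mem_ofPred_eq, hV]; rw [Finset.sum_range_succ'],
            ← lintegral_indicator_one hS']
          rfl
      _ = _ := this
      _ = _ := by
          refine lintegral_congr fun w => ?_
          rw [← lintegral_indicator_one measurableSet_Iic]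
          refine lintegral_congr fun y => ?_
          simp only [indicator, mem_ofPred_eq, mem_Iic, Pi.one_apply]
          congr 1
          simp only [eq_iff_iff]
          constructor <;> intro <;> linarith
  have e2 : ∫⁻ ω, ENNReal.ofReal (x - ∑ i ∈ Finset.range (n + 1), v (i + 1) ω) ∂P
      = ∫⁻ w, ∫⁻ y, ENNReal.ofReal (x - w - y) ∂F ∂(P.map V) := by
    have := lintegral_comp_of_indepFun hVm (hvm (n + 1)) hVn
      (f := fun q => ENNReal.ofReal (x - q.1 - q.2)) (by fun_prop)
    rw [h.law_renewal _ (by omega)] at this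
    rw [← this]
    refine lintegral_congr fun ω => ?_
    rw [Finset.sum_range_succ, sub_sub]
  have e3 : ∫⁻ ω, ENNReal.ofReal (x - V ω) ∂P = ∫⁻ w, ENNReal.ofReal (x - w) ∂(P.map V) := by
    rw [lintegral_map (by fun_prop) hVm]
  rw [e1, e2, e3, ← lintegral_add_right]
  · exact lintegral_congr fun w =>
      equilibriumLaw_Iic_add_lintegral hF.nonneg hF.mean_eq_one (x - w)
  · exact Measurable.lintegral_prod_right' (f := fun q : ℝ × ℝ => ENNReal.ofReal (x - q.1 - q.2))
      (by fun_prop)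

theorem IsIIDSeq.lintegral_ofReal_sub_walk_le {x : ℕ → Ω → ℝ} (hx : IsIIDSeq P F x)
    (hF : F (Iio 0) = 0) (t : ℝ) (k : ℕ) :
    ∫⁻ ω, ENNReal.ofReal (t - ∑ i ∈ Finset.range k, x i ω) ∂P
      ≤ ENNReal.ofReal t * P {ω | ∑ i ∈ Finset.range k, x i ω ≤ t} := by
  have hm : MeasurableSet {ω | ∑ i ∈ Finset.range k, x i ω ≤ t} :=
    measurableSet_le (Finset.measurable_sum _ fun i _ => hx.measurable i) measurable_const
  rw [← lintegral_indicator_const hm]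
  refine lintegral_mono_ae ?_
  filter_upwards [hx.ae_nonneg hF] with ω hω
  by_cases h : ∑ i ∈ Finset.range k, x i ω ≤ t
  · rw [indicator_of_mem (by exact h)]
    have := Finset.sum_nonneg fun i (_ : i ∈ Finset.range k) => hω i
    exact ENNReal.ofReal_le_ofReal (by linarith)
  · rw [ENNReal.ofReal_of_nonpos (by linarith)]
    exact zero_le

/-- The renewal equation: the mean number of epochs up to time `x` is `x`. -/
theorem IsStationaryRenewalSeq.tsum_measure_epoch_le [IsProbabilityMeasure P]
    [IsProbabilityMeasure F] (h : IsStationaryRenewalSeq P F v)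
    (hF : IsUnitMeanLaw F p) (hp : 2 ≤ p) (x : ℝ) :
    ∑' n : ℕ, P {ω | ∑ i ∈ Finset.range (n + 1), v i ω ≤ x} = ENNReal.ofReal x := by
  set I : ℕ → ℝ≥0∞ := fun n =>
    ∫⁻ ω, ENNReal.ofReal (x - ∑ i ∈ Finset.range n, v (i + 1) ω) ∂P with hI
  have hpart : ∀ K, ∑ n ∈ Finset.range K, P {ω | ∑ i ∈ Finset.range (n + 1), v i ω ≤ x} + I K
      = ENNReal.ofReal x := by
    intro K
    induction K with
    | zero => simp [hI]
    | succ K ih =>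
      rw [Finset.sum_range_succ, add_assoc, ← ih]
      congr 1
      exact h.measure_epoch_le_add hF K x
  obtain ⟨r, hr0, hr1, hr⟩ := hF.exists_measure_walk_le hp
  have hlim : Filter.Tendsto I Filter.atTop (nhds 0) := by
    have h1 : Filter.Tendsto (fun k : ℕ => ENNReal.ofReal x * ENNReal.ofReal (r ^ k)) Filter.atTop
        (nhds 0) := by
      have := ENNReal.tendsto_ofReal (tendsto_pow_atTop_nhds_zero_of_lt_one hr0.le hr1)
      rw [ENNReal.ofReal_zero] at this
      simpa using ENNReal.Tendsto.const_mul this (Or.inr ENNReal.ofReal_ne_top)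
    refine tendsto_of_tendsto_of_tendsto_of_le_of_le' tendsto_const_nhds h1
      (Filter.Eventually.of_forall fun _ => zero_le) ?_
    have h2 : ∀ᶠ k : ℕ in Filter.atTop, 2 * x ≤ k :=
      tendsto_natCast_atTop_atTop.eventually_ge_atTop (2 * x)
    filter_upwards [h2] with k hk
    refine (h.isIIDSeq.lintegral_ofReal_sub_walk_le hF.nonneg x k).trans ?_
    gcongr
    refine (measure_mono fun ω hω => ?_).trans (hr h.isIIDSeq k)
    simp only [mem_ofPred_eq] at hω ⊢
    linarith
  have ht := (ENNReal.tendsto_nat_tsum fun n : ℕ =>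
    P {ω | ∑ i ∈ Finset.range (n + 1), v i ω ≤ x}).add hlim
  simp only [hpart, add_zero] at ht
  exact (tendsto_nhds_unique ht tendsto_const_nhds)

/-- The mean measure of the epochs is Lebesgue measure. -/
theorem IsStationaryRenewalSeq.tsum_measure_epoch_mem_Ioc [IsProbabilityMeasure P]
    [IsProbabilityMeasure F] (h : IsStationaryRenewalSeq P F v)
    (hF : IsUnitMeanLaw F p) (hp : 2 ≤ p) {a : ℝ} (ha : 0 ≤ a) (b : ℝ) :
    ∑' n : ℕ, P {ω | ∑ i ∈ Finset.range (n + 1), v i ω ∈ Ioc a b} = ENNReal.ofReal (b - a) := by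
  rcases le_or_gt b a with hba | hab
  · simp [Ioc_eq_empty_of_le hba, ENNReal.ofReal_of_nonpos (sub_nonpos.2 hba)]
  have h1 : ∀ n : ℕ, P {ω | ∑ i ∈ Finset.range (n + 1), v i ω ≤ b}
      = P {ω | ∑ i ∈ Finset.range (n + 1), v i ω ≤ a}
        + P {ω | ∑ i ∈ Finset.range (n + 1), v i ω ∈ Ioc a b} := fun n => by
    have hm : Measurable fun ω => ∑ i ∈ Finset.range (n + 1), v i ω :=
      Finset.measurable_sum _ fun i _ => h.measurable i
    have hmI : MeasurableSet {ω | ∑ i ∈ Finset.range (n + 1), v i ω ∈ Ioc a b} :=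
      hm measurableSet_Ioc
    rw [← measure_union _ hmI]
    · congr 1; ext ω
      simp only [mem_ofPred_eq, mem_union, mem_Ioc]
      constructor
      · intro hb
        rcases le_or_gt (∑ i ∈ Finset.range (n + 1), v i ω) a with h2 | h2
        · exact Or.inl h2
        · exact Or.inr ⟨h2, hb⟩
      · rintro (h2 | h2)
        · linarith
        · exact h2.2
    · refine Set.disjoint_left.2 fun ω h2 h3 => ?_
      simp only [mem_ofPred_eq, mem_Ioc] at h2 h3
      linarith [h3.1]
  have h2 := h.tsum_measure_epoch_le hF hp b
  simp only [h1] at h2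
  rw [ENNReal.tsum_add, h.tsum_measure_epoch_le hF hp a,
    show b = a + (b - a) by ring, ENNReal.ofReal_add ha (by linarith)] at h2
  rw [add_sub_cancel] at h2
  exact (ENNReal.add_right_inj ENNReal.ofReal_ne_top).1 h2

/-- The law of the number `J` of epochs in `(s, t]` depends on `t - s` only:
`(J - k)⁺` counts the epochs in `(s, t]` whose `k`-th successor is also there, and the mean
measure of the epochs is Lebesgue measure, so that `E (J - k)⁺ = E (t - s - V)⁺`, with `V` a sum of
`k` renewal times. -/
theorem IsStationaryRenewalSeq.lintegral_count_sub [IsProbabilityMeasure P]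
    [IsProbabilityMeasure F] (h : IsStationaryRenewalSeq P F v)
    (hF : IsUnitMeanLaw F p) (hp : 2 ≤ p) (s t : ℝ≥0) (k : ℕ) :
    ∫⁻ ω, ENNReal.ofReal ((renewalCount v t ω : ℝ) - renewalCount v s ω - k) ∂P
      = ∫⁻ ω, ENNReal.ofReal ((t : ℝ) - s - ∑ i ∈ Finset.range k, v (i + 1) ω) ∂P := by
  have hvm := h.measurable
  have hSm : ∀ n, Measurable fun ω => ∑ i ∈ Finset.range n, v i ω := fun n =>
    Finset.measurable_sum _ fun i _ => hvm i
  set V : Ω → ℝ := fun ω => ∑ i ∈ Finset.range k, v (i + 1) ω with hV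
  have hVm : Measurable V := Finset.measurable_sum _ fun i _ => hvm _
  have hA : ∀ n : ℕ, MeasurableSet {ω | (s : ℝ) < ∑ i ∈ Finset.range (n + 1), v i ω ∧
        ∑ i ∈ Finset.range (n + k + 1), v i ω ≤ t} := fun n =>
    (measurableSet_lt measurable_const (hSm _)).inter (measurableSet_le (hSm _) measurable_const)
  have hB : MeasurableSet {q : ℝ × ℝ | (s : ℝ) < q.2 ∧ q.1 + q.2 ≤ t} :=
    (measurableSet_lt measurable_const measurable_snd).inter
      (measurableSet_le (measurable_fst.add measurable_snd) measurable_const)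
  have hBs : ∀ w : ℝ, Prod.mk w ⁻¹' {q : ℝ × ℝ | (s : ℝ) < q.2 ∧ q.1 + q.2 ≤ t}
      = Ioc (s : ℝ) (t - w) := fun w => by
    ext y
    simp only [mem_preimage, mem_ofPred_eq, mem_Ioc]
    constructor <;> rintro ⟨h1, h2⟩ <;> exact ⟨h1, by linarith⟩
  have hL : ∀ n : ℕ, IsProbabilityMeasure
      (P.map fun ω => ∑ i ∈ Finset.range (n + 1), v i ω) := fun n =>
    Measure.isProbabilityMeasure_map (hSm _).aemeasurable
  have hmeas : ∀ n : ℕ, Measurable fun w : ℝ =>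
      (P.map fun ω => ∑ i ∈ Finset.range (n + 1), v i ω) (Ioc (s : ℝ) (t - w)) := fun n => by
    simp only [← hBs]
    exact measurable_measure_prodMk_left hB
  have hone : ∀ n : ℕ, P {ω | (s : ℝ) < ∑ i ∈ Finset.range (n + 1), v i ω ∧
        ∑ i ∈ Finset.range (n + k + 1), v i ω ≤ t}
      = ∫⁻ w, (P.map fun ω => ∑ i ∈ Finset.range (n + 1), v i ω) (Ioc (s : ℝ) (t - w))
          ∂(P.map V) := by
    intro n
    set W : Ω → ℝ := fun ω => ∑ i ∈ Finset.range k, v (n + i + 1) ω with hW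
    have hWm : Measurable W := Finset.measurable_sum _ fun i _ => hvm _
    have hind : IndepFun W (fun ω => ∑ i ∈ Finset.range (n + 1), v i ω) P := by
      have := indepFun_blocks hvm h.indep (s := Finset.Ico (n + 1) (n + 1 + k))
        (t := Finset.range (n + 1)) (Finset.disjoint_left.2 fun i h1 h2 => by
          rw [Finset.mem_Ico] at h1; rw [Finset.mem_range] at h2; omega)
      convert this using 1
      ext ω
      rw [hW, Finset.sum_Ico_eq_sum_range]
      simp only [add_tsub_cancel_left]
      exact Finset.sum_congr rfl fun i _ => by rw [show n + i + 1 = n + 1 + i by omega]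
    have hlaw : P.map W = P.map V := (h.isIIDSeq.identDistrib_sum_shift n k).map_eq
    rw [← hlaw]
    have h1 := (indepFun_iff_map_prod_eq_prod_map_map hWm.aemeasurable
      (hSm (n + 1)).aemeasurable).1 hind
    have h2 := Measure.prod_apply (μ := P.map W)
      (ν := P.map fun ω => ∑ i ∈ Finset.range (n + 1), v i ω) hB
    simp only [hBs] at h2
    rw [← h2, ← h1, Measure.map_apply (hWm.prodMk (hSm _)) hB]
    congr 1
    ext ω
    simp only [mem_ofPred_eq, mem_preimage]
    have e : ∑ i ∈ Finset.range (n + k + 1), v i ω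
        = W ω + ∑ i ∈ Finset.range (n + 1), v i ω := by
      rw [show n + k + 1 = n + 1 + k by omega, Finset.sum_range_add (fun i => v i ω), add_comm]
      congr 1
      exact Finset.sum_congr rfl fun i _ => by rw [show n + i + 1 = n + 1 + i by omega]
    rw [e]
  calc _ = ∫⁻ ω, ∑' n : ℕ, {ω | (s : ℝ) < ∑ i ∈ Finset.range (n + 1), v i ω ∧
        ∑ i ∈ Finset.range (n + k + 1), v i ω ≤ t}.indicator (fun _ => (1 : ℝ≥0∞)) ω ∂P := by
        refine lintegral_congr_ae ?_
        filter_upwards [h.ae_isRegularPath hF hp] with ω hω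
        exact (hω.tsum_pairs s t k).symm
    _ = ∑' n : ℕ, P {ω | (s : ℝ) < ∑ i ∈ Finset.range (n + 1), v i ω ∧
        ∑ i ∈ Finset.range (n + k + 1), v i ω ≤ t} := by
        rw [lintegral_tsum fun n => (measurable_const.indicator (hA n)).aemeasurable]
        exact tsum_congr fun n => by rw [lintegral_indicator_const (hA n), one_mul]
    _ = ∫⁻ w, ∑' n : ℕ, (P.map fun ω => ∑ i ∈ Finset.range (n + 1), v i ω)
          (Ioc (s : ℝ) (t - w)) ∂(P.map V) := by
        rw [lintegral_tsum fun n => (hmeas n).aemeasurable]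
        exact tsum_congr hone
    _ = ∫⁻ w, ENNReal.ofReal ((t : ℝ) - s - w) ∂(P.map V) := by
        refine lintegral_congr fun w => ?_
        rw [show (t : ℝ) - s - w = t - w - s by ring,
          ← h.tsum_measure_epoch_mem_Ioc hF hp s.coe_nonneg (t - w)]
        exact tsum_congr fun n => Measure.map_apply (hSm _) measurableSet_Ioc
    _ = _ := lintegral_map (by fun_prop) hVm

end

/-! ### Centred moments of the counts -/

/-- Discrete version of `m ^ p = p (p - 1) ∫ i ^ (p - 2) (m - i)⁺`. -/
theorem natCast_rpow_le_sum {p : ℝ} (hp : 2 ≤ p) (hp3 : p ≤ 3) (m : ℕ) :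
    (m : ℝ) ^ p ≤ 6 * ∑ i ∈ Finset.range m, ((i : ℝ) + 1) ^ (p - 2) * ((m : ℝ) - i) := by
  rcases Nat.eq_zero_or_pos m with rfl | hm
  · simp [Real.zero_rpow (show p ≠ 0 by linarith)]
  have hm0 : (0 : ℝ) < m := by exact_mod_cast hm
  have hcube : ∀ k : ℕ, 6 * ∑ i ∈ Finset.range k, ((i : ℝ) + 1) * ((k : ℝ) - i)
      = k * (k + 1) * (k + 2) := by
    have htri : ∀ k : ℕ, 2 * ∑ i ∈ Finset.range k, ((i : ℝ) + 1) = k * (k + 1) := by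
      intro k
      induction k with
      | zero => simp
      | succ k ih => rw [Finset.sum_range_succ, mul_add, ih]; push_cast; ring
    intro k
    induction k with
    | zero => simp
    | succ k ih =>
      have h1 : ∑ i ∈ Finset.range (k + 1), ((i : ℝ) + 1) * (((k + 1 : ℕ) : ℝ) - i)
          = ∑ i ∈ Finset.range k, ((i : ℝ) + 1) * ((k : ℝ) - i)
            + ∑ i ∈ Finset.range (k + 1), ((i : ℝ) + 1) := by
        rw [Finset.sum_range_succ, Finset.sum_range_succ, ← add_assoc, ← Finset.sum_add_distrib]
        push_cast
        congr 1
        · exact Finset.sum_congr rfl fun i _ => by ring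
        · ring
      have := htri (k + 1)
      rw [h1]; push_cast at this ⊢; linarith
  have hterm : ∀ i ∈ Finset.range m, (m : ℝ) ^ (p - 3) * (((i : ℝ) + 1) * ((m : ℝ) - i))
      ≤ ((i : ℝ) + 1) ^ (p - 2) * ((m : ℝ) - i) := by
    intro i hi
    have hi' : (i : ℝ) + 1 ≤ m := by exact_mod_cast Finset.mem_range.1 hi
    have h0 : (0 : ℝ) < (i : ℝ) + 1 := by positivity
    rw [← mul_assoc]
    refine mul_le_mul_of_nonneg_right ?_ (by linarith)
    calc (m : ℝ) ^ (p - 3) * ((i : ℝ) + 1) ≤ ((i : ℝ) + 1) ^ (p - 3) * ((i : ℝ) + 1) :=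
          mul_le_mul_of_nonneg_right (Real.rpow_le_rpow_of_nonpos h0 hi' (by linarith)) h0.le
      _ = _ := by rw [← Real.rpow_add_one h0.ne']; congr 1; ring
  have h2 := Finset.sum_le_sum hterm
  rw [← Finset.mul_sum] at h2
  have h3 : (m : ℝ) ^ p = (m : ℝ) ^ (p - 3) * (m : ℝ) ^ 3 := by
    rw [← Real.rpow_natCast, ← Real.rpow_add hm0]; norm_num
  have h4 : (m : ℝ) ^ 3 ≤ 6 * ∑ i ∈ Finset.range m, ((i : ℝ) + 1) * ((m : ℝ) - i) := by
    rw [hcube]; nlinarith [sq_nonneg (m : ℝ)]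
  have h5 : 0 ≤ (m : ℝ) ^ (p - 3) := by positivity
  rw [h3]
  nlinarith [mul_le_mul_of_nonneg_left h4 h5]

theorem sum_rpow_mul_max_le {p : ℝ} (hp : 2 ≤ p) (n : ℕ) (x : ℝ) :
    ∑ i ∈ Finset.range n, ((i : ℝ) + 1) ^ (p - 2) * max (x - i) 0 ≤ (|x| + 1) ^ p := by
  have hx1 : (0 : ℝ) < |x| + 1 := by positivity
  have hterm : ∀ i ∈ Finset.range n, ((i : ℝ) + 1) ^ (p - 2) * max (x - i) 0
      ≤ if i ∈ Finset.range ⌈|x|⌉₊ then (|x| + 1) ^ (p - 1) else 0 := by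
    intro i _
    split_ifs with h
    · have hi : (i : ℝ) < |x| := Nat.lt_ceil.1 (Finset.mem_range.1 h)
      have h1 : max (x - i) 0 ≤ |x| + 1 := by
        refine max_le ?_ hx1.le
        have : (0 : ℝ) ≤ i := by positivity
        linarith [le_abs_self x]
      calc ((i : ℝ) + 1) ^ (p - 2) * max (x - i) 0 ≤ (|x| + 1) ^ (p - 2) * (|x| + 1) := by
            gcongr
        _ = _ := by rw [← Real.rpow_add_one hx1.ne']; congr 1; ring
    · have hi : |x| ≤ i := by
        rw [Finset.mem_range, not_lt] at h
        exact Nat.ceil_le.1 h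
      rw [max_eq_right (by linarith [le_abs_self x]), mul_zero]
  refine (Finset.sum_le_sum hterm).trans ?_
  rw [← Finset.sum_filter, Finset.sum_const, nsmul_eq_mul]
  have hc : (((Finset.range n).filter fun i => i ∈ Finset.range ⌈|x|⌉₊).card : ℝ) ≤ |x| + 1 := by
    have h1 : ((Finset.range n).filter fun i => i ∈ Finset.range ⌈|x|⌉₊).card ≤ ⌈|x|⌉₊ := by
      refine (Finset.card_le_card fun i hi => (Finset.mem_filter.1 hi).2).trans_eq ?_
      exact Finset.card_range _
    calc _ ≤ (⌈|x|⌉₊ : ℝ) := by exact_mod_cast h1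
      _ ≤ _ := (Nat.ceil_lt_add_one (abs_nonneg x)).le
  calc _ ≤ (|x| + 1) * (|x| + 1) ^ (p - 1) := by gcongr
    _ = _ := by rw [mul_comm, ← Real.rpow_add_one hx1.ne']; congr 1; ring

theorem add_rpow_le_eight_mul {p a b : ℝ} (hp : 0 ≤ p) (hp3 : p ≤ 3) (ha : 0 ≤ a) (hb : 0 ≤ b) :
    (a + b) ^ p ≤ 8 * (a ^ p + b ^ p) := by
  have h2 : (2 : ℝ) ^ p ≤ 8 := by
    calc (2 : ℝ) ^ p ≤ 2 ^ (3 : ℝ) := Real.rpow_le_rpow_of_exponent_le (by norm_num) hp3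
      _ = 8 := by norm_num
  have hmax : max a b ^ p ≤ a ^ p + b ^ p := by
    have h3 : 0 ≤ a ^ p := by positivity
    have h4 : 0 ≤ b ^ p := by positivity
    rcases le_total a b with h | h
    · rw [max_eq_right h]; linarith
    · rw [max_eq_left h]; linarith
  calc (a + b) ^ p ≤ (2 * max a b) ^ p :=
        Real.rpow_le_rpow (by positivity) (by linarith [le_max_left a b, le_max_right a b]) hp
    _ = 2 ^ p * max a b ^ p := Real.mul_rpow (by norm_num) (ha.trans (le_max_left _ _))
    _ ≤ 8 * (a ^ p + b ^ p) := by gcongr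

section

variable {Ω : Type*} [MeasurableSpace Ω] {P : Measure Ω} {F : Measure ℝ} {p : ℝ}

theorem IsIIDSeq.integrable {x : ℕ → Ω → ℝ} [IsProbabilityMeasure F] (hx : IsIIDSeq P F x)
    (hF : IsUnitMeanLaw F p) (hp : 1 ≤ p) (n : ℕ) : Integrable (x n) P :=
  hx.integrable_comp n measurable_id (hF.integrable_id hp)

theorem IsIIDSeq.integral_walk_sub {x : ℕ → Ω → ℝ} [IsProbabilityMeasure P]
    [IsProbabilityMeasure F] (hx : IsIIDSeq P F x) (hF : IsUnitMeanLaw F p) (hp : 1 ≤ p)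
    (s : Finset ℕ) :
    Integrable (fun ω => ∑ i ∈ s, (x i ω - 1)) P ∧ ∫ ω, ∑ i ∈ s, (x i ω - 1) ∂P = 0 := by
  have h1 : ∀ i, Integrable (fun ω => x i ω - 1) P := fun i =>
    (hx.integrable hF hp i).sub (integrable_const 1)
  refine ⟨integrable_finsetSum _ fun i _ => h1 i, ?_⟩
  rw [integral_finsetSum _ fun i _ => h1 i]
  refine Finset.sum_eq_zero fun i _ => ?_
  rw [integral_sub (hx.integrable hF hp i) (integrable_const 1),
    hx.integral_comp i (f := fun y => y) measurable_id, hF.mean_eq_one]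
  simp

/-- The centred walk is a martingale, and `x ↦ (x - c)⁺` and `x ↦ (c - x)⁺` are convex. -/
theorem IsIIDSeq.integral_max_walk_mono {x : ℕ → Ω → ℝ} [IsProbabilityMeasure P]
    [IsProbabilityMeasure F] (hx : IsIIDSeq P F x) (hF : IsUnitMeanLaw F p) (hp : 1 ≤ p)
    {k n : ℕ} (hkn : k ≤ n) (c : ℝ) :
    ∫ ω, max (∑ i ∈ Finset.range k, (x i ω - 1) - c) 0 ∂P
        ≤ ∫ ω, max (∑ i ∈ Finset.range n, (x i ω - 1) - c) 0 ∂P ∧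
      ∫ ω, max (c - ∑ i ∈ Finset.range k, (x i ω - 1)) 0 ∂P
        ≤ ∫ ω, max (c - ∑ i ∈ Finset.range n, (x i ω - 1)) 0 ∂P := by
  set X : Ω → ℝ := fun ω => ∑ i ∈ Finset.range k, (x i ω - 1) with hX
  set Y : Ω → ℝ := fun ω => ∑ i ∈ Finset.Ico k n, (x i ω - 1) with hY
  have hsum : ∀ ω, ∑ i ∈ Finset.range n, (x i ω - 1) = X ω + Y ω := fun ω =>
    (Finset.sum_range_add_sum_Ico _ hkn).symm
  have hm : ∀ i, Measurable fun ω => x i ω - 1 := fun i => (hx.measurable i).sub_const 1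
  have hXm : Measurable X := Finset.measurable_sum _ fun i _ => hm i
  have hYm : Measurable Y := Finset.measurable_sum _ fun i _ => hm i
  have hind : IndepFun X Y P :=
    indepFun_blocks hm (hx.indep.comp (fun _ y => y - 1) fun _ => by fun_prop)
      (Finset.disjoint_left.2 fun i h1 h2 => by
        rw [Finset.mem_range] at h1; rw [Finset.mem_Ico] at h2; omega)
  obtain ⟨hXi, -⟩ := hx.integral_walk_sub hF hp (Finset.range k)
  obtain ⟨hYi, hY0⟩ := hx.integral_walk_sub hF hp (Finset.Ico k n)
  simp only [hsum]
  constructor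
  · refine (integral_max_zero_le_of_indepFun (X := fun ω => X ω - c) (Y := Y) (hXm.sub_const c)
      hYm (hXi.sub (integrable_const c)) hYi
      (hind.comp (φ := fun y => y - c) (by fun_prop) measurable_id) hY0).trans_eq ?_
    exact integral_congr_ae (ae_of_all _ fun ω => by ring_nf)
  · refine (integral_max_zero_le_of_indepFun (X := fun ω => c - X ω) (Y := fun ω => -Y ω)
      (hXm.const_sub c) hYm.neg ((integrable_const c).sub hXi) hYi.neg
      (hind.comp (φ := fun y => c - y) (ψ := fun y => -y) (by fun_prop) (by fun_prop))
      (by rw [integral_neg, hY0, neg_zero])).trans_eq ?_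
    exact integral_congr_ae (ae_of_all _ fun ω => by ring_nf)

theorem integral_max_zero_eq_lintegral {X : Ω → ℝ} (hX : Measurable X) :
    ∫ ω, max (X ω) 0 ∂P = (∫⁻ ω, ENNReal.ofReal (X ω) ∂P).toReal := by
  rw [integral_eq_lintegral_of_nonneg_ae (f := fun ω => max (X ω) 0)
    (ae_of_all _ fun ω => le_max_right _ _) (hX.max measurable_const).aestronglyMeasurable]
  congr 1
  refine lintegral_congr fun ω => ?_
  rw [ENNReal.ofReal_max]; simp

variable {v : ℕ → Ω → ℝ} [IsProbabilityMeasure P] [IsProbabilityMeasure F]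

theorem IsStationaryRenewalSeq.integrable_count (h : IsStationaryRenewalSeq P F v)
    (hF : IsUnitMeanLaw F p) (hp : 2 ≤ p) {s t : ℝ≥0} (hst : s ≤ t) :
    Integrable (fun ω => (renewalCount v t ω : ℝ) - renewalCount v s ω) P ∧
      ∫ ω, ((renewalCount v t ω : ℝ) - renewalCount v s ω) ∂P = (t : ℝ) - s := by
  have hm : Measurable fun ω => (renewalCount v t ω : ℝ) - renewalCount v s ω :=
    (measurable_renewalCount h.measurable t).sub (measurable_renewalCount h.measurable s)
  have h0 : 0 ≤ᵐ[P] fun ω => (renewalCount v t ω : ℝ) - renewalCount v s ω := by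
    filter_upwards [h.ae_isRegularPath hF hp] with ω hω
    have : (renewalCount v s ω : ℝ) ≤ renewalCount v t ω := by
      exact_mod_cast hω.renewalCount_mono hst
    simpa using this
  have h1 := h.lintegral_count_sub hF hp s t 0
  simp only [Nat.cast_zero, sub_zero, Finset.range_zero, Finset.sum_empty, lintegral_const,
    measure_univ, mul_one] at h1
  refine ⟨(lintegral_ofReal_ne_top_iff_integrable hm.aestronglyMeasurable h0).1
    (by rw [h1]; exact ENNReal.ofReal_ne_top), ?_⟩
  rw [integral_eq_lintegral_of_nonneg_ae h0 hm.aestronglyMeasurable, h1, ENNReal.toReal_ofReal]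
  have : (s : ℝ) ≤ t := by exact_mod_cast hst
  linarith

/-- The duality `E (k - J)⁺ = E (V - (t - s))⁺` for the number `J` of epochs in `(s, t]` and a sum
`V` of `k` renewal times; it follows from the companion for `(J - k)⁺`, as `E J = t - s` and
`E V = k`. -/
theorem IsStationaryRenewalSeq.integral_max_sub_count (h : IsStationaryRenewalSeq P F v)
    (hF : IsUnitMeanLaw F p) (hp : 2 ≤ p) {s t : ℝ≥0} (hst : s ≤ t) (k : ℕ) :
    ∫ ω, max ((k : ℝ) - ((renewalCount v t ω : ℝ) - renewalCount v s ω)) 0 ∂P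
      = ∫ ω, max (∑ i ∈ Finset.range k, v (i + 1) ω - ((t : ℝ) - s)) 0 ∂P := by
  set J : Ω → ℝ := fun ω => (renewalCount v t ω : ℝ) - renewalCount v s ω with hJ
  have hJm : Measurable J :=
    (measurable_renewalCount h.measurable t).sub (measurable_renewalCount h.measurable s)
  obtain ⟨hJi, hJ1⟩ := h.integrable_count hF hp hst
  set V : Ω → ℝ := fun ω => ∑ i ∈ Finset.range k, v (i + 1) ω with hV
  have hVm : Measurable V := Finset.measurable_sum _ fun i _ => h.measurable _
  have hVW : ∀ ω, V ω = ∑ i ∈ Finset.range k, (v (i + 1) ω - 1) + k := fun ω => by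
    simp [hV, Finset.sum_sub_distrib]
  obtain ⟨hWi, hW0⟩ := h.isIIDSeq.integral_walk_sub hF (by linarith) (Finset.range k)
  have hVi : Integrable V P := by
    rw [funext hVW]; exact hWi.add (integrable_const _)
  have hV1 : ∫ ω, V ω ∂P = k := by
    rw [integral_congr_ae (ae_of_all _ hVW), integral_add hWi (integrable_const _), hW0]; simp
  have e : ∫ ω, max (J ω - k) 0 ∂P = ∫ ω, max ((t : ℝ) - s - V ω) 0 ∂P := by
    rw [integral_max_zero_eq_lintegral (hJm.sub_const _),
      integral_max_zero_eq_lintegral (hVm.const_sub _), h.lintegral_count_sub hF hp s t k]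
  have pos : ∀ y : ℝ, max (-y) 0 = max y 0 - y := fun y => by
    rcases le_total 0 y with hy | hy
    · rw [max_eq_left hy, max_eq_right (by linarith)]; ring
    · rw [max_eq_right hy, max_eq_left (by linarith)]; ring
  have i1 : Integrable (fun ω => J ω - k) P := hJi.sub (integrable_const _)
  have i2 : Integrable (fun ω => (t : ℝ) - s - V ω) P := (integrable_const _).sub hVi
  calc ∫ ω, max ((k : ℝ) - J ω) 0 ∂P = ∫ ω, (max (J ω - k) 0 - (J ω - k)) ∂P :=
        integral_congr_ae (ae_of_all _ fun ω => by
          simp only; rw [← pos (J ω - k)]; ring_nf)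
    _ = ∫ ω, max ((t : ℝ) - s - V ω) 0 ∂P - ((t : ℝ) - s - k) := by
        rw [integral_sub i1.pos_part i1, e, integral_sub hJi (integrable_const _), hJ1]; simp
    _ = ∫ ω, (max ((t : ℝ) - s - V ω) 0 - ((t : ℝ) - s - V ω)) ∂P := by
        rw [integral_sub i2.pos_part i2, integral_sub (integrable_const _) hVi, hV1]; simp
    _ = ∫ ω, max (V ω - ((t : ℝ) - s)) 0 ∂P := integral_congr_ae (ae_of_all _ fun ω => by
          simp only; rw [← pos ((t : ℝ) - s - V ω), neg_sub])

/-- Few epochs: comparison with the walk at time `⌊t - s⌋`. -/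
theorem IsUnitMeanLaw.exists_integral_count_deficit_le (hF : IsUnitMeanLaw F p) (hp : 2 ≤ p)
    (hp3 : p ≤ 3) :
    ∃ C : ℝ, 0 ≤ C ∧ ∀ {Ω : Type*} [MeasurableSpace Ω] {P : Measure Ω} [IsProbabilityMeasure P]
      {v : ℕ → Ω → ℝ}, IsStationaryRenewalSeq P F v → ∀ {s t : ℝ≥0}, s ≤ t →
        ∫ ω, ∑ i ∈ Finset.range ⌊(t : ℝ) - s⌋₊, ((i : ℝ) + 1) ^ (p - 2) *
          max ((⌊(t : ℝ) - s⌋₊ : ℝ) - i - ((renewalCount v t ω : ℝ) - renewalCount v s ω)) 0 ∂P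
          ≤ C * ((t : ℝ) - s) ^ (p / 2) := by
  obtain ⟨C, hC, hwalk⟩ := hF.exists_walk_moment_le hp hp3
  refine ⟨8 * (C + 1), by positivity, ?_⟩
  intro Ω _ P _ v h s t hst
  have hτ0 : (0 : ℝ) ≤ (t : ℝ) - s := sub_nonneg.2 (by exact_mod_cast hst)
  set τ : ℝ := (t : ℝ) - s with hτ
  set n : ℕ := ⌊τ⌋₊ with hn
  have hnτ : (n : ℝ) ≤ τ := Nat.floor_le hτ0
  rcases Nat.eq_zero_or_pos n with h0 | h0
  · rw [h0]; simp; positivity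
  have hn1 : (1 : ℝ) ≤ n := by exact_mod_cast h0
  obtain ⟨hJi, -⟩ := h.integrable_count hF hp hst
  set W : ℕ → Ω → ℝ := fun k ω => ∑ i ∈ Finset.range k, (v (i + 1) ω - 1) with hW
  have hWi : ∀ k, Integrable (W k) P := fun k =>
    (h.isIIDSeq.integral_walk_sub hF (by linarith) (Finset.range k)).1
  have hterm : ∀ i ∈ Finset.range n,
      ∫ ω, max ((n : ℝ) - i - ((renewalCount v t ω : ℝ) - renewalCount v s ω)) 0 ∂P
        ≤ ∫ ω, max (W n ω - i) 0 ∂P := by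
    intro i hi
    have hin : i ≤ n := (Finset.mem_range.1 hi).le
    have e := h.integral_max_sub_count hF hp hst (n - i)
    rw [Nat.cast_sub hin] at e
    rw [e]
    refine le_trans (integral_mono_ae ?_ ((hWi (n - i)).sub (integrable_const (i : ℝ))).pos_part
      (ae_of_all _ fun ω => ?_))
      (h.isIIDSeq.integral_max_walk_mono hF (by linarith) (Nat.sub_le n i) i).1
    · have : ∀ ω, ∑ j ∈ Finset.range (n - i), v (j + 1) ω = W (n - i) ω + ((n - i : ℕ) : ℝ) :=
        fun ω => by simp [hW, Finset.sum_sub_distrib]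
      simp only [this]
      exact (((hWi _).add (integrable_const _)).sub (integrable_const _)).pos_part
    · have : ∑ j ∈ Finset.range (n - i), v (j + 1) ω = W (n - i) ω + ((n : ℝ) - i) := by
        simp [hW, Finset.sum_sub_distrib, Nat.cast_sub hin]
      simp only [Pi.sub_apply, this]
      exact max_le_max (by linarith) le_rfl
  have i1 : ∀ i : ℕ, Integrable (fun ω => ((i : ℝ) + 1) ^ (p - 2) *
      max ((n : ℝ) - i - ((renewalCount v t ω : ℝ) - renewalCount v s ω)) 0) P := fun i =>
    (((integrable_const _).sub hJi).pos_part).const_mul _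
  have i2 : ∀ i : ℕ, Integrable (fun ω => ((i : ℝ) + 1) ^ (p - 2) * max (W n ω - i) 0) P :=
    fun i => (((hWi n).sub (integrable_const _)).pos_part).const_mul _
  obtain ⟨i3, hmom⟩ : Integrable (fun ω => |W n ω| ^ p) P ∧ ∫ ω, |W n ω| ^ p ∂P
      ≤ C * ((Finset.range n).card : ℝ) ^ (p / 2) := hwalk h.isIIDSeq _
  rw [Finset.card_range] at hmom
  calc _ = ∑ i ∈ Finset.range n, ((i : ℝ) + 1) ^ (p - 2) *
        ∫ ω, max ((n : ℝ) - i - ((renewalCount v t ω : ℝ) - renewalCount v s ω)) 0 ∂P := by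
        rw [integral_finsetSum _ fun i _ => i1 i]
        exact Finset.sum_congr rfl fun i _ => integral_const_mul _ _
    _ ≤ ∑ i ∈ Finset.range n, ((i : ℝ) + 1) ^ (p - 2) * ∫ ω, max (W n ω - i) 0 ∂P :=
        Finset.sum_le_sum fun i hi => mul_le_mul_of_nonneg_left (hterm i hi) (by positivity)
    _ = ∫ ω, ∑ i ∈ Finset.range n, ((i : ℝ) + 1) ^ (p - 2) * max (W n ω - i) 0 ∂P := by
        rw [integral_finsetSum _ fun i _ => i2 i]
        exact Finset.sum_congr rfl fun i _ => (integral_const_mul _ _).symm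
    _ ≤ ∫ ω, 8 * (|W n ω| ^ p + 1) ∂P := by
        refine integral_mono (integrable_finsetSum _ fun i _ => i2 i)
          ((i3.add (integrable_const 1)).const_mul 8) fun ω => ?_
        refine (sum_rpow_mul_max_le hp n (W n ω)).trans ?_
        have := add_rpow_le_eight_mul (p := p) (by linarith) hp3 (abs_nonneg (W n ω)) zero_le_one
        rwa [Real.one_rpow] at this
    _ = 8 * (∫ ω, |W n ω| ^ p ∂P + 1) := by
        rw [integral_const_mul, integral_add i3 (integrable_const 1), integral_const, probReal_univ,
          one_smul]
    _ ≤ 8 * (C * (n : ℝ) ^ (p / 2) + (n : ℝ) ^ (p / 2)) := by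
        have := Real.one_le_rpow hn1 (show 0 ≤ p / 2 by linarith)
        gcongr
    _ = 8 * (C + 1) * (n : ℝ) ^ (p / 2) := by ring
    _ ≤ _ := by gcongr

/-- Many epochs: comparison with the walk at a time of order `t - s`, up to which Rosenthal's
inequality is used; beyond it the Chernoff bound gives a geometric series. -/
theorem IsUnitMeanLaw.exists_lintegral_count_surplus_le (hF : IsUnitMeanLaw F p) (hp : 2 ≤ p)
    (hp3 : p ≤ 3) :
    ∃ C : ℝ, 0 ≤ C ∧ ∀ {Ω : Type*} [MeasurableSpace Ω] {P : Measure Ω} [IsProbabilityMeasure P]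
      {v : ℕ → Ω → ℝ}, IsStationaryRenewalSeq P F v → ∀ {s t : ℝ≥0}, s ≤ t →
        ∫⁻ ω, ∑' i : ℕ, ENNReal.ofReal (((i : ℝ) + 1) ^ (p - 2)) *
          ENNReal.ofReal ((renewalCount v t ω : ℝ) - renewalCount v s ω
            - (⌊(t : ℝ) - s⌋₊ + i : ℕ)) ∂P
          ≤ ENNReal.ofReal (C * (((t : ℝ) - s) + ((t : ℝ) - s) ^ (p / 2))) := by
  obtain ⟨C, hC, hwalk⟩ := hF.exists_walk_moment_le hp hp3
  obtain ⟨r, hr0, hr1, hch⟩ := hF.exists_measure_walk_le hp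
  have hsummable : Summable fun i : ℕ => ((i : ℝ) + 1) * r ^ i := by
    have h1 := summable_pow_mul_geometric_of_norm_lt_one 1
      (show ‖r‖ < 1 by rw [Real.norm_of_nonneg hr0.le]; exact hr1)
    have h2 := summable_geometric_of_lt_one hr0.le hr1
    refine (h1.add h2).congr fun i => ?_
    simp; ring
  set R : ℝ := ∑' i : ℕ, ((i : ℝ) + 1) * r ^ i with hR
  have hR0 : 0 ≤ R := tsum_nonneg fun i => by positivity
  refine ⟨3 + R + 8 * (15 * C + 8), by positivity, ?_⟩
  intro Ω _ P _ v h s t hst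
  have hτ0 : (0 : ℝ) ≤ (t : ℝ) - s := sub_nonneg.2 (by exact_mod_cast hst)
  have hx := h.isIIDSeq
  have hJm : Measurable fun ω => (renewalCount v t ω : ℝ) - renewalCount v s ω :=
    (measurable_renewalCount h.measurable t).sub (measurable_renewalCount h.measurable s)
  rw [lintegral_tsum fun i => ((hJm.sub_const _).ennreal_ofReal.const_mul _).aemeasurable]
  have hid : ∀ i : ℕ, ∫⁻ ω, ENNReal.ofReal (((i : ℝ) + 1) ^ (p - 2)) *
      ENNReal.ofReal ((renewalCount v t ω : ℝ) - renewalCount v s ω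
        - (⌊(t : ℝ) - s⌋₊ + i : ℕ)) ∂P
      = ENNReal.ofReal (((i : ℝ) + 1) ^ (p - 2)) * ∫⁻ ω, ENNReal.ofReal ((t : ℝ) - s
        - ∑ j ∈ Finset.range (⌊(t : ℝ) - s⌋₊ + i), v (j + 1) ω) ∂P := fun i => by
    rw [lintegral_const_mul _ (by fun_prop), h.lintegral_count_sub hF hp s t]
  simp only [hid]
  set τ : ℝ := (t : ℝ) - s with hτ
  set n : ℕ := ⌊τ⌋₊ with hn
  have hnτ : (n : ℝ) ≤ τ := Nat.floor_le hτ0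
  have hτn : τ < n + 1 := Nat.lt_floor_add_one τ
  set A : ℕ → ℝ≥0∞ := fun i => ∫⁻ ω, ENNReal.ofReal (τ
    - ∑ j ∈ Finset.range (n + i), v (j + 1) ω) ∂P with hA
  have hq : ∀ i : ℕ, ((i : ℝ) + 1) ^ (p - 2) ≤ (i : ℝ) + 1 := fun i => by
    have : (1 : ℝ) ≤ (i : ℝ) + 1 := by simp
    simpa using Real.rpow_le_rpow_of_exponent_le this (show p - 2 ≤ 1 by linarith)
  -- from `i = 3 n + 2` on, `τ` is less than half the mean `n + i` of the walk
  have htail : ∀ i : ℕ, 3 * n + 2 ≤ i → A i ≤ ENNReal.ofReal (τ * r ^ i) := by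
    intro i hi
    refine (hx.lintegral_ofReal_sub_walk_le hF.nonneg τ (n + i)).trans ?_
    rw [ENNReal.ofReal_mul hτ0]
    gcongr
    calc _ ≤ P {ω | ∑ j ∈ Finset.range (n + i), v (j + 1) ω ≤ ((n + i : ℕ) : ℝ) / 2} := by
          refine measure_mono fun ω hω => ?_
          simp only [mem_ofPred_eq] at hω ⊢
          have : (3 * n + 2 : ℝ) ≤ i := by exact_mod_cast hi
          push_cast
          linarith
      _ ≤ ENNReal.ofReal (r ^ (n + i)) := hch hx _
      _ ≤ _ := ENNReal.ofReal_le_ofReal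
          (pow_le_pow_of_le_one hr0.le hr1.le (Nat.le_add_left i n))
  -- for `n = 0` the head consists of two terms, each of them at most of order `τ`
  have hhead : ∑ i ∈ Finset.range (3 * n + 2), ENNReal.ofReal (((i : ℝ) + 1) ^ (p - 2)) * A i
      ≤ ENNReal.ofReal (3 * τ + 8 * (15 * C + 8) * τ ^ (p / 2)) := by
    rcases Nat.eq_zero_or_pos n with h0 | h0
    · have hle : ∀ i, A i ≤ ENNReal.ofReal τ := fun i => by
        refine (hx.lintegral_ofReal_sub_walk_le hF.nonneg τ (n + i)).trans ?_
        exact mul_le_of_le_one_right zero_le prob_le_one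
      rw [h0]
      calc _ ≤ ∑ i ∈ Finset.range 2, ENNReal.ofReal ((i : ℝ) + 1) * ENNReal.ofReal τ := by
            refine Finset.sum_le_sum fun i _ => ?_
            exact mul_le_mul' (ENNReal.ofReal_le_ofReal (hq i)) (hle i)
        _ = ENNReal.ofReal (3 * τ) := by
            rw [Finset.sum_range_succ, Finset.sum_range_one, ← ENNReal.ofReal_mul (by positivity),
              ← ENNReal.ofReal_mul (by positivity), ← ENNReal.ofReal_add (by positivity)
              (by positivity)]
            congr 1; push_cast; ring
        _ ≤ _ := ENNReal.ofReal_le_ofReal (by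
            have : 0 ≤ 8 * (15 * C + 8) * τ ^ (p / 2) := by positivity
            linarith)
    · have hn1 : (1 : ℝ) ≤ n := by exact_mod_cast h0
      set W : ℕ → Ω → ℝ := fun k ω => ∑ i ∈ Finset.range k, (v (i + 1) ω - 1) with hW
      have hWi : ∀ k, Integrable (W k) P := fun k =>
        (hx.integral_walk_sub hF (by linarith) (Finset.range k)).1
      have hVW : ∀ k ω, ∑ j ∈ Finset.range k, v (j + 1) ω = W k ω + k := fun k ω => by
        simp [hW, Finset.sum_sub_distrib]
      set K : ℕ := n + (3 * n + 2) with hK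
      have hterm : ∀ i ∈ Finset.range (3 * n + 2),
          A i ≤ ENNReal.ofReal (∫ ω, max ((1 - W K ω) - i) 0 ∂P) := by
        intro i hi
        have hiK : n + i ≤ K := by rw [hK]; have := Finset.mem_range.1 hi; omega
        have hint : Integrable (fun ω => max ((1 - i : ℝ) - W (n + i) ω) 0) P :=
          ((integrable_const _).sub (hWi _)).pos_part
        have h1 : A i ≤ ENNReal.ofReal (∫ ω, max ((1 - i : ℝ) - W (n + i) ω) 0 ∂P) := by
          rw [ofReal_integral_eq_lintegral_ofReal hint (ae_of_all _ fun ω => le_max_right _ _)]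
          refine lintegral_mono fun ω => ENNReal.ofReal_le_ofReal ?_
          refine le_max_of_le_left ?_
          rw [hVW]; push_cast; linarith
        refine h1.trans (ENNReal.ofReal_le_ofReal ?_)
        refine (hx.integral_max_walk_mono hF (by linarith) hiK (1 - i : ℝ)).2.trans_eq ?_
        exact integral_congr_ae (ae_of_all _ fun ω => by simp only [hW]; ring_nf)
      have i2 : ∀ i : ℕ, Integrable
          (fun ω => ((i : ℝ) + 1) ^ (p - 2) * max ((1 - W K ω) - i) 0) P := fun i =>
        ((((integrable_const _).sub (hWi K)).sub (integrable_const _)).pos_part).const_mul _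
      obtain ⟨i3, hmom⟩ : Integrable (fun ω => |W K ω| ^ p) P ∧ ∫ ω, |W K ω| ^ p ∂P
          ≤ C * ((Finset.range K).card : ℝ) ^ (p / 2) := hwalk hx _
      rw [Finset.card_range] at hmom
      have hKτ : (K : ℝ) ≤ 6 * τ := by
        rw [hK]; push_cast; linarith
      have h6 : (6 : ℝ) ^ (p / 2) ≤ 15 := by
        calc (6 : ℝ) ^ (p / 2) ≤ 6 ^ (3 / 2 : ℝ) :=
              Real.rpow_le_rpow_of_exponent_le (by norm_num) (by linarith)
          _ = Real.sqrt (6 ^ 3) := by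
              rw [Real.sqrt_eq_rpow, ← Real.rpow_natCast, ← Real.rpow_mul (by norm_num)]
              norm_num
          _ ≤ 15 := Real.sqrt_le_iff.2 ⟨by norm_num, by norm_num⟩
      have hτ1 : 1 ≤ τ ^ (p / 2) := Real.one_le_rpow (hn1.trans hnτ) (by linarith)
      calc _ ≤ ∑ i ∈ Finset.range (3 * n + 2), ENNReal.ofReal (((i : ℝ) + 1) ^ (p - 2))
              * ENNReal.ofReal (∫ ω, max ((1 - W K ω) - i) 0 ∂P) :=
            Finset.sum_le_sum fun i hi => mul_le_mul_right (hterm i hi) _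
        _ = ENNReal.ofReal (∫ ω, ∑ i ∈ Finset.range (3 * n + 2),
              ((i : ℝ) + 1) ^ (p - 2) * max ((1 - W K ω) - i) 0 ∂P) := by
            rw [integral_finsetSum _ fun i _ => i2 i, ENNReal.ofReal_sum_of_nonneg fun i _ =>
              integral_nonneg fun ω => mul_nonneg (by positivity) (le_max_right _ _)]
            refine Finset.sum_congr rfl fun i _ => ?_
            rw [integral_const_mul, ENNReal.ofReal_mul (by positivity)]
        _ ≤ ENNReal.ofReal (8 * (15 * C + 8) * τ ^ (p / 2)) := by
            refine ENNReal.ofReal_le_ofReal ?_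
            calc _ ≤ ∫ ω, 8 * (|W K ω| ^ p + 8) ∂P := by
                  refine integral_mono (integrable_finsetSum _ fun i _ => i2 i)
                    ((i3.add (integrable_const 8)).const_mul 8) fun ω => ?_
                  refine (sum_rpow_mul_max_le hp _ (1 - W K ω)).trans ?_
                  have e1 : |1 - W K ω| + 1 ≤ |W K ω| + 2 := by
                    have := abs_sub (1 : ℝ) (W K ω)
                    rw [abs_one] at this; linarith
                  refine (Real.rpow_le_rpow (by positivity) e1 (by linarith)).trans ?_
                  refine (add_rpow_le_eight_mul (by linarith) hp3 (abs_nonneg _)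
                    (by norm_num)).trans ?_
                  gcongr
                  calc (2 : ℝ) ^ p ≤ 2 ^ (3 : ℝ) :=
                        Real.rpow_le_rpow_of_exponent_le (by norm_num) hp3
                    _ = 8 := by norm_num
              _ = 8 * (∫ ω, |W K ω| ^ p ∂P + 8) := by
                  rw [integral_const_mul, integral_add i3 (integrable_const 8), integral_const,
                    probReal_univ, one_smul]
              _ ≤ 8 * (C * (15 * τ ^ (p / 2)) + 8 * τ ^ (p / 2)) := by
                  have e2 : (K : ℝ) ^ (p / 2) ≤ 15 * τ ^ (p / 2) := by
                    calc (K : ℝ) ^ (p / 2) ≤ (6 * τ) ^ (p / 2) :=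
                          Real.rpow_le_rpow (by positivity) hKτ (by linarith)
                      _ = 6 ^ (p / 2) * τ ^ (p / 2) := Real.mul_rpow (by norm_num) hτ0
                      _ ≤ _ := by gcongr
                  have e3 := hmom.trans (mul_le_mul_of_nonneg_left e2 hC)
                  linarith
              _ = _ := by ring
        _ ≤ _ := ENNReal.ofReal_le_ofReal (by linarith)
  have hsplit : ∀ i : ℕ, ENNReal.ofReal (((i : ℝ) + 1) ^ (p - 2)) * A i
      ≤ (if i ∈ Finset.range (3 * n + 2) then ENNReal.ofReal (((i : ℝ) + 1) ^ (p - 2)) * A i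
          else 0) + ENNReal.ofReal (τ * (((i : ℝ) + 1) * r ^ i)) := by
    intro i
    split_ifs with hi
    · exact le_self_add
    · rw [Finset.mem_range, not_lt] at hi
      rw [zero_add]
      refine (mul_le_mul' (ENNReal.ofReal_le_ofReal (hq i)) (htail i hi)).trans_eq ?_
      rw [← ENNReal.ofReal_mul (by positivity)]
      congr 1; ring
  calc _ ≤ _ := ENNReal.tsum_le_tsum hsplit
    _ = ∑ i ∈ Finset.range (3 * n + 2), ENNReal.ofReal (((i : ℝ) + 1) ^ (p - 2)) * A i
        + ENNReal.ofReal (τ * R) := by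
        rw [ENNReal.tsum_add]
        congr 1
        · rw [tsum_eq_sum (s := Finset.range (3 * n + 2)) fun i hi => if_neg hi]
          exact Finset.sum_congr rfl fun i hi => if_pos hi
        · rw [← ENNReal.ofReal_tsum_of_nonneg (fun i => by positivity) (hsummable.mul_left τ),
            tsum_mul_left]
    _ ≤ ENNReal.ofReal (3 * τ + 8 * (15 * C + 8) * τ ^ (p / 2)) + ENNReal.ofReal (τ * R) := by
        gcongr
    _ ≤ _ := by
        rw [← ENNReal.ofReal_add (by positivity) (by positivity)]
        refine ENNReal.ofReal_le_ofReal ?_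
        have e1 : 0 ≤ (3 + R) * τ ^ (p / 2) := by positivity
        have e2 : 0 ≤ 8 * (15 * C + 8) * τ := by positivity
        nlinarith

/-- The centred counts of a stationary renewal process have `p`-th moments of order
`τ + τ ^ (p / 2)` over every interval of length `τ`. -/
theorem IsUnitMeanLaw.exists_count_moment_le (hF : IsUnitMeanLaw F p) (hp : 2 ≤ p)
    (hp3 : p ≤ 3) :
    ∃ C : ℝ, 0 ≤ C ∧ ∀ {Ω : Type*} [MeasurableSpace Ω] {P : Measure Ω} [IsProbabilityMeasure P]
      {v : ℕ → Ω → ℝ}, IsStationaryRenewalSeq P F v → ∀ {s t : ℝ≥0}, s ≤ t →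
        Integrable (fun ω =>
          |(t : ℝ) - s - ((renewalCount v t ω : ℝ) - renewalCount v s ω)| ^ p) P ∧
        ∫ ω, |(t : ℝ) - s - ((renewalCount v t ω : ℝ) - renewalCount v s ω)| ^ p ∂P
          ≤ C * (((t : ℝ) - s) + ((t : ℝ) - s) ^ (p / 2)) := by
  obtain ⟨C₁, hC₁, hdef⟩ := hF.exists_integral_count_deficit_le hp hp3
  obtain ⟨C₂, hC₂, hsur⟩ := hF.exists_lintegral_count_surplus_le hp hp3
  refine ⟨8 * (1 + 6 * C₁ + 6 * C₂), by positivity, ?_⟩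
  intro Ω _ P _ v h s t hst
  have hτ0 : (0 : ℝ) ≤ (t : ℝ) - s := sub_nonneg.2 (by exact_mod_cast hst)
  have hd := hdef h hst
  have hs := hsur h hst
  obtain ⟨hJi, -⟩ := h.integrable_count hF hp hst
  have hJm : Measurable fun ω => (renewalCount v t ω : ℝ) - renewalCount v s ω :=
    (measurable_renewalCount h.measurable t).sub (measurable_renewalCount h.measurable s)
  set τ : ℝ := (t : ℝ) - s with hτ
  set n : ℕ := ⌊τ⌋₊ with hn
  have hnτ : (n : ℝ) ≤ τ := Nat.floor_le hτ0
  have hτn : τ < n + 1 := Nat.lt_floor_add_one τ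
  set L : Ω → ℝ := fun ω => ∑ i ∈ Finset.range n, ((i : ℝ) + 1) ^ (p - 2) *
    max ((n : ℝ) - i - ((renewalCount v t ω : ℝ) - renewalCount v s ω)) 0 with hL
  set U : Ω → ℝ≥0∞ := fun ω => ∑' i : ℕ, ENNReal.ofReal (((i : ℝ) + 1) ^ (p - 2)) *
    ENNReal.ofReal ((renewalCount v t ω : ℝ) - renewalCount v s ω - (n + i : ℕ)) with hU
  have hL0 : ∀ ω, 0 ≤ L ω := fun ω => Finset.sum_nonneg fun i _ =>
    mul_nonneg (by positivity) (le_max_right _ _)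
  have hLi : Integrable L P := integrable_finsetSum _ fun i _ =>
    (((integrable_const _).sub hJi).pos_part).const_mul _
  have hUm : Measurable U := Measurable.tsum fun i => by fun_prop
  have hpt : ∀ᵐ ω ∂P,
      ENNReal.ofReal (|τ - ((renewalCount v t ω : ℝ) - renewalCount v s ω)| ^ p)
        ≤ ENNReal.ofReal (8 * τ) + (ENNReal.ofReal (48 * L ω) + 48 * U ω) := by
    filter_upwards [h.ae_isRegularPath hF hp] with ω hω
    set m : ℕ := renewalCount v t ω - renewalCount v s ω with hm
    have hmJ : (renewalCount v t ω : ℝ) - renewalCount v s ω = m := by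
      rw [hm, Nat.cast_sub (hω.renewalCount_mono hst)]
    have hτp : (τ - n) ^ p ≤ τ := by
      calc (τ - n) ^ p ≤ (τ - n) ^ (1 : ℝ) :=
            Real.rpow_le_rpow_of_exponent_ge' (by linarith) (by linarith) (by norm_num)
              (by linarith)
        _ = τ - n := Real.rpow_one _
        _ ≤ τ := by have : (0 : ℝ) ≤ n := by positivity
                    linarith
    have h1 : |τ - m| ^ p ≤ 8 * (τ + |(n : ℝ) - m| ^ p) := by
      have e : |τ - m| ≤ (τ - n) + |(n : ℝ) - m| := by
        calc |τ - m| = |(τ - n) + ((n : ℝ) - m)| := by congr 1; ring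
          _ ≤ |τ - n| + |(n : ℝ) - m| := abs_add_le _ _
          _ = _ := by rw [abs_of_nonneg (by linarith : 0 ≤ τ - n)]
      refine (Real.rpow_le_rpow (abs_nonneg _) e (by linarith)).trans ?_
      refine (add_rpow_le_eight_mul (by linarith) hp3 (by linarith) (abs_nonneg _)).trans ?_
      gcongr
    have h2 : ENNReal.ofReal (|(n : ℝ) - m| ^ p)
        ≤ ENNReal.ofReal (6 * L ω) + 6 * U ω := by
      rcases le_total m n with hmn | hmn
      · refine le_trans (ENNReal.ofReal_le_ofReal ?_) le_self_add
        have e : |(n : ℝ) - m| = ((n - m : ℕ) : ℝ) := by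
          rw [Nat.cast_sub hmn, abs_of_nonneg (sub_nonneg.2 (by exact_mod_cast hmn))]
        rw [e]
        refine (natCast_rpow_le_sum hp hp3 (n - m)).trans ?_
        gcongr
        simp only [hL, hmJ]
        refine (Finset.sum_le_sum fun i _ => ?_).trans
          (Finset.sum_le_sum_of_subset_of_nonneg
            (Finset.range_subset_range.2 (Nat.sub_le n m))
            fun i _ _ => mul_nonneg (by positivity) (le_max_right _ _))
        gcongr
        refine le_max_of_le_left ?_
        rw [Nat.cast_sub hmn]; linarith
      · refine le_trans ?_ le_add_self
        have e : |(n : ℝ) - m| = ((m - n : ℕ) : ℝ) := by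
          rw [Nat.cast_sub hmn, abs_sub_comm,
            abs_of_nonneg (sub_nonneg.2 (by exact_mod_cast hmn))]
        rw [e]
        refine (ENNReal.ofReal_le_ofReal (natCast_rpow_le_sum hp hp3 (m - n))).trans ?_
        rw [ENNReal.ofReal_mul (by norm_num), ENNReal.ofReal_ofNat]
        gcongr
        rw [ENNReal.ofReal_sum_of_nonneg fun i hi => mul_nonneg (by positivity) (by
          have : (i : ℝ) < (m - n : ℕ) := by exact_mod_cast Finset.mem_range.1 hi
          linarith)]
        refine le_trans (Finset.sum_le_sum fun i _ => ?_)
          (ENNReal.sum_le_tsum (Finset.range (m - n)))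
        rw [ENNReal.ofReal_mul (by positivity), hmJ]
        refine mul_le_mul_right (ENNReal.ofReal_le_ofReal ?_) _
        rw [Nat.cast_sub hmn]; push_cast; linarith
    rw [hmJ]
    calc ENNReal.ofReal (|τ - m| ^ p) ≤ ENNReal.ofReal (8 * (τ + |(n : ℝ) - m| ^ p)) :=
          ENNReal.ofReal_le_ofReal h1
      _ = ENNReal.ofReal (8 * τ) + 8 * ENNReal.ofReal (|(n : ℝ) - m| ^ p) := by
          rw [mul_add, ENNReal.ofReal_add (by positivity) (by positivity),
            ENNReal.ofReal_mul (p := 8) (q := |(n : ℝ) - m| ^ p) (by norm_num),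
            ENNReal.ofReal_ofNat]
      _ ≤ ENNReal.ofReal (8 * τ) + 8 * (ENNReal.ofReal (6 * L ω) + 6 * U ω) := by gcongr
      _ = _ := by
          rw [mul_add, ← mul_assoc, show (48 : ℝ) * L ω = 8 * (6 * L ω) by ring,
            ENNReal.ofReal_mul (p := 8) (by norm_num), ENNReal.ofReal_ofNat]
          norm_num
  have hm : Measurable fun ω =>
      |τ - ((renewalCount v t ω : ℝ) - renewalCount v s ω)| ^ p := by fun_prop
  have hC : 0 ≤ 8 * (1 + 6 * C₁ + 6 * C₂) * (τ + τ ^ (p / 2)) := by positivity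
  have hlin : ∫⁻ ω,
      ENNReal.ofReal (|τ - ((renewalCount v t ω : ℝ) - renewalCount v s ω)| ^ p) ∂P
      ≤ ENNReal.ofReal (8 * (1 + 6 * C₁ + 6 * C₂) * (τ + τ ^ (p / 2))) := by
    calc _ ≤ _ := lintegral_mono_ae hpt
      _ = ENNReal.ofReal (8 * τ) + (∫⁻ ω, ENNReal.ofReal (48 * L ω) ∂P + 48 * ∫⁻ ω, U ω ∂P) := by
          rw [lintegral_add_left measurable_const, lintegral_add_right _ (hUm.const_mul _),
            lintegral_const_mul _ hUm]
          simp
      _ ≤ ENNReal.ofReal (8 * τ) + (ENNReal.ofReal (48 * (C₁ * τ ^ (p / 2)))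
            + 48 * ENNReal.ofReal (C₂ * (τ + τ ^ (p / 2)))) := by
          gcongr
          rw [← ofReal_integral_eq_lintegral_ofReal (hLi.const_mul 48)
            (ae_of_all _ fun ω => mul_nonneg (by norm_num) (hL0 ω)), integral_const_mul]
          exact ENNReal.ofReal_le_ofReal (by linarith)
      _ ≤ _ := by
          rw [show (48 : ℝ≥0∞) = ENNReal.ofReal 48 by simp, ← ENNReal.ofReal_mul (by norm_num),
            ← ENNReal.ofReal_add (by positivity) (by positivity),
            ← ENNReal.ofReal_add (by positivity) (by positivity)]
          refine ENNReal.ofReal_le_ofReal ?_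
          have e1 : 0 ≤ τ ^ (p / 2) := by positivity
          have e2 : 0 ≤ C₁ * τ := by positivity
          nlinarith
  have hi : Integrable (fun ω =>
      |τ - ((renewalCount v t ω : ℝ) - renewalCount v s ω)| ^ p) P :=
    (lintegral_ofReal_ne_top_iff_integrable hm.aestronglyMeasurable
      (ae_of_all _ fun ω => by positivity)).1 (ne_top_of_le_ne_top ENNReal.ofReal_ne_top hlin)
  refine ⟨hi, ?_⟩
  rw [← ofReal_integral_eq_lintegral_ofReal hi (ae_of_all _ fun ω => by positivity)] at hlin
  exact (ENNReal.ofReal_le_ofReal_iff hC).1 hlin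

end

/-! ### The two parts of the excess -/

theorem lintegral_enorm_rpow_le_of_integral_le {Ω : Type*} [MeasurableSpace Ω] {P : Measure Ω}
    {Z : Ω → ℝ} {p B : ℝ} (hp : 0 ≤ p) (hi : Integrable (fun ω => |Z ω| ^ p) P)
    (hB : ∫ ω, |Z ω| ^ p ∂P ≤ B) : ∫⁻ ω, ‖Z ω‖ₑ ^ p ∂P ≤ ENNReal.ofReal B := by
  have h : ∀ ω, ‖Z ω‖ₑ ^ p = ENNReal.ofReal (|Z ω| ^ p) := fun ω => by
    rw [Real.enorm_eq_ofReal_abs, ENNReal.ofReal_rpow_of_nonneg (abs_nonneg _) hp]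
  simp only [h]
  rw [← ofReal_integral_eq_lintegral_ofReal hi (ae_of_all _ fun ω => by positivity)]
  exact ENNReal.ofReal_le_ofReal hB

/-- The arrival part: a random walk with small negative drift. -/
theorem IsUnitMeanLaw.exists_lintegral_iSup_walk_le {F : Measure ℝ} [IsProbabilityMeasure F]
    {p : ℝ} (hF : IsUnitMeanLaw F p) (hp : 2 < p) (hp3 : p ≤ 3) :
    ∃ C : ℝ, 0 ≤ C ∧ ∀ {Ω : Type*} [MeasurableSpace Ω] {P : Measure Ω} [IsProbabilityMeasure P]
      {x : ℕ → Ω → ℝ}, IsIIDSeq P F x → ∀ a : ℝ, 0 < a → a ≤ 1 →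
        ∫⁻ ω, ⨆ j : ℕ, ENNReal.ofReal (-(∑ i ∈ Finset.range j, (x i ω - 1)) - a * j) ∂P
          ≤ ENNReal.ofReal (C / a) := by
  obtain ⟨K, hK, hmom⟩ := hF.exists_walk_moment_le hp.le hp3
  obtain ⟨C, hC, hsup⟩ := lintegral_iSup_sub_drift_le hp hK
  refine ⟨C, hC, fun {Ω} _ {P} _ {x} hx a ha ha1 => ?_⟩
  refine hsup (fun j ω => -(∑ i ∈ Finset.range j, (x i ω - 1)))
    (fun j => (Finset.measurable_sum _ fun i _ => (hx.measurable i).sub_const 1).neg)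
    (fun ω => by simp) (fun i j hij => ?_) a ha ha1
  have h1 : ∀ ω, ‖-(∑ k ∈ Finset.range j, (x k ω - 1)) - -(∑ k ∈ Finset.range i, (x k ω - 1))‖ₑ
      = ‖∑ k ∈ Finset.Ico i j, (x k ω - 1)‖ₑ := fun ω => by
    rw [← Finset.sum_range_add_sum_Ico _ hij, ← enorm_neg]
    congr 1; ring
  simp only [h1]
  obtain ⟨h2, h3⟩ := hmom hx (Finset.Ico i j)
  refine (lintegral_enorm_rpow_le_of_integral_le (by linarith) h2 h3).trans_eq ?_
  rw [Nat.card_Ico, ENNReal.ofReal_mul hK,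
    ← ENNReal.ofReal_rpow_of_nonneg (by positivity) (by linarith), ENNReal.ofReal_natCast]

/-- The centred superposition of `N` renewal processes, sampled at the times `j / N`. The count at
time `0` is almost surely `0`; it is subtracted so that the process starts at `0` everywhere. -/
noncomputable def centredSuperposition {Ω : Type*} {N : ℕ} (v : Fin N → ℕ → Ω → ℝ) (j : ℕ)
    (ω : Ω) : ℝ :=
  ∑ i : Fin N, ((j : ℝ) / N - ((renewalCount (v i) (j / N) ω : ℝ) - renewalCount (v i) 0 ω))

theorem measurable_centredSuperposition {Ω : Type*} [MeasurableSpace Ω] {N : ℕ}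
    {v : Fin N → ℕ → Ω → ℝ} (hv : ∀ i n, Measurable (v i n)) (j : ℕ) :
    Measurable (centredSuperposition v j) :=
  Finset.measurable_sum _ fun i _ => measurable_const.sub
    ((measurable_renewalCount (hv i) _).sub (measurable_renewalCount (hv i) _))

/-- Rosenthal's inequality for the superposition. In the time unit `1 / N` the term
`N * τ` of the `p`-th moments is negligible, because the grid excludes shorter intervals. -/
theorem IsUnitMeanLaw.exists_superposition_increment_le {F : Measure ℝ} [IsProbabilityMeasure F]
    {p : ℝ} (hF : IsUnitMeanLaw F p) (hp : 2 < p) (hp3 : p ≤ 3) :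
    ∃ K : ℝ, 0 ≤ K ∧ ∀ {Ω : Type*} [MeasurableSpace Ω] {P : Measure Ω} [IsProbabilityMeasure P]
      {N : ℕ} {v : Fin N → ℕ → Ω → ℝ}, 0 < N → (∀ i, IsStationaryRenewalSeq P F (v i)) →
      iIndepFun (fun (i : Fin N) (ω : Ω) (n : ℕ) => v i n ω) P → ∀ k j : ℕ, k ≤ j →
        ∫⁻ ω, ‖centredSuperposition v j ω - centredSuperposition v k ω‖ₑ ^ p ∂P
          ≤ ENNReal.ofReal K * ((j - k : ℕ) : ℝ≥0∞) ^ (p / 2) := by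
  obtain ⟨Cp, hCp, hmomp⟩ := hF.exists_count_moment_le hp.le hp3
  obtain ⟨C2, hC2, hmom2⟩ := (hF.mono zero_le_two hp.le).exists_count_moment_le le_rfl
    (by norm_num)
  refine ⟨110 * ((2 * (C2 + 1)) ^ (p / 2) + 2 * Cp), by positivity, ?_⟩
  intro Ω _ P _ N v hN hv hind k j hkj
  rcases hkj.eq_or_lt with rfl | hlt
  · simp [show 0 < p by linarith]
  have hN0 : (0 : ℝ) < N := by exact_mod_cast hN
  have hN1 : (1 : ℝ) ≤ N := by exact_mod_cast hN
  set s : ℝ≥0 := k / N with hs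
  set t : ℝ≥0 := j / N with ht
  have hsR : (s : ℝ) = k / N := by simp [hs]
  have htR : (t : ℝ) = j / N := by simp [ht]
  have hst : s ≤ t := by
    rw [← NNReal.coe_le_coe, hsR, htR]; gcongr
  set d : ℝ := ((j - k : ℕ) : ℝ) with hd
  have hd1 : 1 ≤ d := by
    have : 1 ≤ j - k := by omega
    rw [hd]; exact_mod_cast this
  set τ : ℝ := (t : ℝ) - s with hτ
  have hNτ : N * τ = d := by
    rw [hτ, hsR, htR, hd, Nat.cast_sub hkj]; field_simp
  have hτ0 : 0 < τ := by
    have : 0 < N * τ := by linarith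
    exact (pos_iff_pos_of_mul_pos this).1 hN0
  set Y : Fin N → Ω → ℝ := fun i ω =>
    τ - ((renewalCount (v i) t ω : ℝ) - renewalCount (v i) s ω) with hY
  have hYm : ∀ i, Measurable (Y i) := fun i => measurable_const.sub
    ((measurable_renewalCount (hv i).measurable _).sub
      (measurable_renewalCount (hv i).measurable _))
  have hYind : iIndepFun Y P := by
    -- the count is a measurable function of the whole sequence of renewal times
    have hg : ∀ r : ℝ≥0, Measurable fun y : ℕ → ℝ =>
        (renewalCount (fun n (y : ℕ → ℝ) => y n) r y : ℝ) := fun r =>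
      measurable_renewalCount (fun n => measurable_pi_apply n) r
    exact hind.comp (fun _ y => τ - ((renewalCount (fun n (y : ℕ → ℝ) => y n) t y : ℝ)
      - renewalCount (fun n (y : ℕ → ℝ) => y n) s y))
      fun _ => measurable_const.sub ((hg t).sub (hg s))
  have hY0 : ∀ i, ∫ ω, Y i ω ∂P = 0 := fun i => by
    obtain ⟨h1, h2⟩ := (hv i).integrable_count hF hp.le hst
    rw [hY, integral_sub (integrable_const _) h1, h2]
    simp [hτ]
  have hYa : ∀ i, ∫ ω, Y i ω ^ 2 ∂P ≤ 2 * (C2 + 1) * τ := fun i => by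
    have h1 := (hmom2 (hv i) hst).2
    simp only [Real.rpow_two, sq_abs, div_self (two_ne_zero' ℝ), Real.rpow_one] at h1
    refine h1.trans ?_
    linarith
  have hsum : ∀ ω, centredSuperposition v j ω - centredSuperposition v k ω
      = ∑ i ∈ Finset.univ, Y i ω := fun ω => by
    rw [centredSuperposition, centredSuperposition, ← Finset.sum_sub_distrib]
    refine Finset.sum_congr rfl fun i _ => ?_
    simp only [hY, hτ, hsR, htR]; ring
  simp only [hsum]
  obtain ⟨h1, h2⟩ := integral_abs_sum_rpow_le hp.le hp3 hYm hYind hY0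
    (fun i => (hmomp (hv i) hst).1) (a := 2 * (C2 + 1) * τ) (by positivity) hYa
    (fun i => (hmomp (hv i) hst).2) Finset.univ
  refine (lintegral_enorm_rpow_le_of_integral_le (by linarith) h1 h2).trans ?_
  rw [← ENNReal.ofReal_natCast, ENNReal.ofReal_rpow_of_nonneg (by positivity) (by linarith),
    ← ENNReal.ofReal_mul (by positivity)]
  refine ENNReal.ofReal_le_ofReal ?_
  rw [Finset.card_univ, Fintype.card_fin, ← hd]
  have e1 : (N * (2 * (C2 + 1) * τ)) ^ (p / 2) = (2 * (C2 + 1)) ^ (p / 2) * d ^ (p / 2) := by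
    rw [show N * (2 * (C2 + 1) * τ) = 2 * (C2 + 1) * (N * τ) by ring, hNτ,
      Real.mul_rpow (by positivity) (by positivity)]
  have e2 : d ≤ d ^ (p / 2) := by
    simpa using Real.rpow_le_rpow_of_exponent_le hd1 (show (1 : ℝ) ≤ p / 2 by linarith)
  have e3 : N * τ ^ (p / 2) ≤ d ^ (p / 2) := by
    rw [← hNτ, Real.mul_rpow hN0.le hτ0.le]
    gcongr
    simpa using Real.rpow_le_rpow_of_exponent_le hN1 (show (1 : ℝ) ≤ p / 2 by linarith)
  have e4 : N * (Cp * (τ + τ ^ (p / 2))) ≤ Cp * (2 * d ^ (p / 2)) := by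
    calc N * (Cp * (τ + τ ^ (p / 2))) = Cp * (N * τ + N * τ ^ (p / 2)) := by ring
      _ ≤ Cp * (2 * d ^ (p / 2)) := by gcongr; linarith
  rw [e1]
  nlinarith

theorem IsUnitMeanLaw.exists_lintegral_iSup_superposition_le {F : Measure ℝ}
    [IsProbabilityMeasure F] {p : ℝ} (hF : IsUnitMeanLaw F p) (hp : 2 < p) (hp3 : p ≤ 3) :
    ∃ C : ℝ, 0 ≤ C ∧ ∀ {Ω : Type*} [MeasurableSpace Ω] {P : Measure Ω} [IsProbabilityMeasure P]
      {N : ℕ} {v : Fin N → ℕ → Ω → ℝ}, 0 < N → (∀ i, IsStationaryRenewalSeq P F (v i)) →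
      iIndepFun (fun (i : Fin N) (ω : Ω) (n : ℕ) => v i n ω) P → ∀ a : ℝ, 0 < a → a ≤ 1 →
        ∫⁻ ω, ⨆ j : ℕ, ENNReal.ofReal (centredSuperposition v j ω - a * j) ∂P
          ≤ ENNReal.ofReal (C / a) := by
  obtain ⟨K, hK, hinc⟩ := hF.exists_superposition_increment_le hp hp3
  obtain ⟨C, hC, hsup⟩ := lintegral_iSup_sub_drift_le hp hK
  exact ⟨C, hC, fun {Ω} _ {P} _ {N v} hN hv hind a ha ha1 =>
    hsup (centredSuperposition v)
      (measurable_centredSuperposition fun i n => (hv i).measurable n)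
      (fun ω => by simp [centredSuperposition]) (hinc hN hv hind) a ha ha1⟩

/-- Along a regular path, `A (t)` is controlled by the walk of the renewal times, because the
count jumps at the epochs only. -/
theorem IsRegularPath.renewalCount_sub_le {Ω : Type*} {u : ℕ → Ω → ℝ} {ω : Ω}
    (h : IsRegularPath fun n => u n ω) {lam δ : ℝ} (hlam : 0 < lam) (hδ : 0 ≤ δ) (t : ℝ≥0) :
    ENNReal.ofReal ((renewalCount u t ω : ℝ) - (1 + δ) * lam * t)
      ≤ 1 + ENNReal.ofReal (1 + δ) * ⨆ j : ℕ, ENNReal.ofReal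
        (-(∑ i ∈ Finset.range j, (lam * u (i + 1) ω - 1)) - δ / (1 + δ) * j) := by
  have hδ1 : 0 < 1 + δ := by linarith
  rcases Nat.eq_zero_or_pos (renewalCount u t ω) with h0 | h0
  · rw [h0, ENNReal.ofReal_of_nonpos]
    · exact zero_le
    · have : 0 ≤ (1 + δ) * lam * t := by positivity
      simpa using this
  obtain ⟨m, hm⟩ : ∃ m, renewalCount u t ω = m + 1 := ⟨_, (Nat.sub_add_cancel h0).symm⟩
  have h1 : ∑ i ∈ Finset.range (m + 1), u i ω ≤ t :=
    (h.lt_renewalCount_iff t m).1 (by omega)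
  rw [Finset.sum_range_succ'] at h1
  have h2 : ∑ i ∈ Finset.range m, u (i + 1) ω ≤ t := by linarith [h.nonneg 0]
  have h3 : ∑ i ∈ Finset.range m, (lam * u (i + 1) ω - 1)
      = lam * ∑ i ∈ Finset.range m, u (i + 1) ω - m := by
    simp [Finset.sum_sub_distrib, Finset.mul_sum]
  have h4 : (renewalCount u t ω : ℝ) - (1 + δ) * lam * t
      ≤ 1 + (1 + δ) * (-(∑ i ∈ Finset.range m, (lam * u (i + 1) ω - 1)) - δ / (1 + δ) * m) := by
    rw [hm, h3]
    have e : (1 + δ) * (δ / (1 + δ) * m) = δ * m := by field_simp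
    rw [mul_sub, e]
    have := mul_le_mul_of_nonneg_left h2 (show 0 ≤ (1 + δ) * lam by positivity)
    push_cast
    linarith
  refine (ENNReal.ofReal_le_ofReal h4).trans (ENNReal.ofReal_add_le.trans ?_)
  rw [ENNReal.ofReal_one, ENNReal.ofReal_mul hδ1.le]
  gcongr
  exact le_iSup (fun j : ℕ => ENNReal.ofReal
    (-(∑ i ∈ Finset.range j, (lam * u (i + 1) ω - 1)) - δ / (1 + δ) * j)) m

/-- Between two points of the grid the centred superposition can only grow through its
deterministic part, by at most `1`. -/
theorem ofReal_sum_sub_renewalCount_le {Ω : Type*} {N : ℕ} (hN : 0 < N) {v : Fin N → ℕ → Ω → ℝ}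
    {ω : Ω} (h : ∀ i, IsRegularPath fun n => v i n ω) (h0 : ∀ i, renewalCount (v i) 0 ω = 0)
    {a : ℝ} (ha : 0 ≤ a) (t : ℝ≥0) :
    ENNReal.ofReal (∑ i : Fin N, ((t : ℝ) - renewalCount (v i) t ω) - a * N * t)
      ≤ 1 + ⨆ j : ℕ, ENNReal.ofReal (centredSuperposition v j ω - a * j) := by
  have hN0 : (0 : ℝ) < N := by exact_mod_cast hN
  set j : ℕ := ⌊(N : ℝ) * t⌋₊ with hj
  have hj1 : (j : ℝ) ≤ N * t := Nat.floor_le (by positivity)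
  have hj2 : (N : ℝ) * t < j + 1 := Nat.lt_floor_add_one _
  have hle : (j / N : ℝ≥0) ≤ t := by
    rw [← NNReal.coe_le_coe]; push_cast
    rw [div_le_iff₀ hN0]; linarith
  have h1 : ∑ i : Fin N, ((t : ℝ) - renewalCount (v i) t ω) ≤ 1 + centredSuperposition v j ω := by
    have h2 : ∀ i ∈ Finset.univ, (t : ℝ) - renewalCount (v i) t ω ≤ ((t : ℝ) - j / N)
        + ((j : ℝ) / N - ((renewalCount (v i) (j / N) ω : ℝ) - renewalCount (v i) 0 ω)) := by
      intro i _
      have : (renewalCount (v i) (j / N) ω : ℝ) ≤ renewalCount (v i) t ω := by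
        exact_mod_cast (h i).renewalCount_mono hle
      rw [h0 i]; push_cast; linarith
    refine (Finset.sum_le_sum h2).trans ?_
    rw [Finset.sum_add_distrib, centredSuperposition]
    gcongr
    simp only [Finset.sum_const, Finset.card_univ, Fintype.card_fin, nsmul_eq_mul]
    rw [mul_sub, mul_div_cancel₀ _ hN0.ne']
    linarith
  have h3 : ∑ i : Fin N, ((t : ℝ) - renewalCount (v i) t ω) - a * N * t
      ≤ 1 + (centredSuperposition v j ω - a * j) := by
    have := mul_le_mul_of_nonneg_left hj1 ha
    linarith
  refine (ENNReal.ofReal_le_ofReal h3).trans (ENNReal.ofReal_add_le.trans ?_)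
  rw [ENNReal.ofReal_one]
  gcongr
  exact le_iSup (fun j : ℕ => ENNReal.ofReal (centredSuperposition v j ω - a * j)) j

/-! ### The scaled supremum -/

theorem measurable_excess {Ω : Type*} [MeasurableSpace Ω] {N : ℕ} {u : ℕ → Ω → ℝ}
    {v : Fin N → ℕ → Ω → ℝ} (hu : ∀ n, Measurable (u n)) (hv : ∀ i n, Measurable (v i n))
    (t : ℝ≥0) : Measurable (excess u v t) :=
  (measurable_renewalCount hu t).sub
    (Finset.measurable_sum _ fun i _ => measurable_renewalCount (hv i) t)

/-- By right-continuity the paths of the excess take all their values along a dense sequence of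
times, so that the supremum is measurable. -/
theorem range_excess_eq {Ω : Type*} {N : ℕ} {u : ℕ → Ω → ℝ} {v : Fin N → ℕ → Ω → ℝ} {ω : Ω}
    (hu : IsRegularPath fun n => u n ω) (hv : ∀ i, IsRegularPath fun n => v i n ω) :
    range (fun t : ℝ≥0 => excess u v t ω)
      = range fun n : ℕ => excess u v (TopologicalSpace.denseSeq ℝ≥0 n) ω := by
  refine Subset.antisymm ?_ ?_
  · rintro _ ⟨t, rfl⟩
    have h1 : ∀ᶠ t' in nhdsWithin t (Ioi t), excess u v t' ω = excess u v t ω := by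
      filter_upwards [hu.eventually_renewalCount_eq t,
        Filter.eventually_all.2 fun i => (hv i).eventually_renewalCount_eq t] with t' h2 h3
      simp only [excess, h2, h3]
    obtain ⟨b, hb, hsub⟩ := mem_nhdsGT_iff_exists_Ioo_subset.1 h1
    obtain ⟨n, hn⟩ := (TopologicalSpace.denseRange_denseSeq ℝ≥0).exists_mem_open isOpen_Ioo
      (nonempty_Ioo.2 hb)
    exact ⟨n, hsub hn⟩
  · rintro _ ⟨n, rfl⟩
    exact ⟨_, rfl⟩

theorem aemeasurable_scaledSupremum {Ω : Type*} [MeasurableSpace Ω] {P : Measure Ω} {N : ℕ}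
    {u : ℕ → Ω → ℝ} {v : Fin N → ℕ → Ω → ℝ} (hu : ∀ n, Measurable (u n))
    (hv : ∀ i n, Measurable (v i n)) (hur : ∀ᵐ ω ∂P, IsRegularPath fun n => u n ω)
    (hvr : ∀ᵐ ω ∂P, ∀ i, IsRegularPath fun n => v i n ω) :
    AEMeasurable (scaledSupremum u v) P := by
  refine ⟨fun ω => (1 / √(N : ℝ)) * ⨆ n : ℕ, excess u v (TopologicalSpace.denseSeq ℝ≥0 n) ω,
    (Measurable.iSup fun n => measurable_excess hu hv _).const_mul _, ?_⟩
  filter_upwards [hur, hvr] with ω h1 h2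
  rw [scaledSupremum, iSup, iSup, range_excess_eq h1 h2]

/-- The value of the excess at time `0` makes the supremum nonnegative. -/
theorem bddAbove_and_ofReal_scaledSupremum_le {Ω : Type*} {N : ℕ} {u : ℕ → Ω → ℝ}
    {v : Fin N → ℕ → Ω → ℝ} {ω : Ω} {B : ℝ≥0∞} (hB : B ≠ ∞)
    (h : ∀ t, ENNReal.ofReal (excess u v t ω) ≤ B) (h0 : ∀ i, renewalCount (v i) 0 ω = 0) :
    BddAbove (range fun t : ℝ≥0 => excess u v t ω) ∧ 0 ≤ scaledSupremum u v ω ∧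
      ENNReal.ofReal (scaledSupremum u v ω) ≤ ENNReal.ofReal (1 / √(N : ℝ)) * B := by
  have hle : ∀ t, excess u v t ω ≤ B.toReal := fun t => (ENNReal.ofReal_le_iff_le_toReal hB).1 (h t)
  have hb : BddAbove (range fun t : ℝ≥0 => excess u v t ω) :=
    ⟨B.toReal, by rintro _ ⟨t, rfl⟩; exact hle t⟩
  have h1 : 0 ≤ ⨆ t : ℝ≥0, excess u v t ω := by
    refine le_trans ?_ (le_ciSup hb 0)
    simp [excess, h0]
  refine ⟨hb, mul_nonneg (by positivity) h1, ?_⟩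
  rw [scaledSupremum, ENNReal.ofReal_mul (by positivity)]
  gcongr
  exact (ENNReal.ofReal_le_iff_le_toReal hB).2 (ciSup_le hle)

theorem IsUnitMeanLaw.of_hasFiniteTwoPlusMoment {F : Measure ℝ} [IsProbabilityMeasure F]
    (h0 : F (Iio 0) = 0) (h1 : ∫ x, x ∂F = 1) (h2 : HasFiniteTwoPlusMoment F) :
    ∃ p : ℝ, 2 < p ∧ p ≤ 3 ∧ IsUnitMeanLaw F p := by
  obtain ⟨ε, hε, hi⟩ := h2
  refine ⟨min (2 + ε) 3, lt_min (by linarith) (by norm_num), min_le_right _ _, ?_⟩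
  exact IsUnitMeanLaw.mono ⟨h0, h1, hi⟩ (le_min (by linarith) (by norm_num)) (min_le_left _ _)

theorem IsStationaryRenewalSeq.isIIDSeq_mul {Ω : Type*} [MeasurableSpace Ω] {P : Measure Ω}
    {F : Measure ℝ} {u : ℕ → Ω → ℝ} {lam : ℝ} (hlam : lam ≠ 0)
    (h : IsStationaryRenewalSeq P (F.map fun x => x / lam) u) :
    IsIIDSeq P F fun n ω => lam * u (n + 1) ω := by
  have hx := h.isIIDSeq
  have hm : Measurable fun y : ℝ => lam * y := by fun_prop
  refine ⟨fun n => (hx.measurable n).const_mul lam, fun n => ?_,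
    hx.indep.comp (fun _ y => lam * y) fun _ => hm⟩
  have h1 : P.map (fun ω => lam * u (n + 1) ω) = (P.map (u (n + 1))).map fun y => lam * y :=
    (Measure.map_map hm (hx.measurable n)).symm
  rw [h1, h.law_renewal _ (by omega), Measure.map_map hm (by fun_prop)]
  have h2 : ((fun y : ℝ => lam * y) ∘ fun x => x / lam) = id := by
    ext x; simp [mul_div_cancel₀ _ hlam]
  rw [h2, Measure.map_id]

theorem mainTheorem6 (β : ℝ) (hβ : 0 < β)
    (GE : Measure ℝ) [IsProbabilityMeasure GE] (hGE : IsAdmissibleInterarrivalLaw GE)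
    (G : Measure ℝ) [IsProbabilityMeasure G] (hG : IsAdmissibleServiceLaw G)
    (hGmom : HasFiniteTwoPlusMoment G) :
    ∃ C : ℝ, ∀ N : ℕ, 0 < arrivalRate β N →
      ∀ (Ω : Type*) [MeasurableSpace Ω] (P : Measure Ω) [IsProbabilityMeasure P]
        (u : ℕ → Ω → ℝ) (v : Fin N → ℕ → Ω → ℝ),
        IsStationaryRenewalSeq P (GE.map fun x => x / arrivalRate β N) u →
        (∀ i, IsStationaryRenewalSeq P G (v i)) →
        iIndepFun (fun (i : Fin N) (ω : Ω) (n : ℕ) => v i n ω) P →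
        IndepFun (fun (ω : Ω) (n : ℕ) => u n ω)
          (fun (ω : Ω) (i : Fin N) (n : ℕ) => v i n ω) P →
        (∀ᵐ ω ∂P, BddAbove (range fun t : ℝ≥0 => excess u v t ω)) ∧
          Integrable (scaledSupremum u v) P ∧
          ∫ ω, scaledSupremum u v ω ∂P ≤ C := by
  obtain ⟨p, hp, hp3, hFE⟩ :=
    IsUnitMeanLaw.of_hasFiniteTwoPlusMoment hGE.nonneg hGE.mean_eq_one hGE.moment
  have hG0 : G (Iio 0) = 0 := by
    have h1 : G (Iic 0) = 0 := by
      rw [← ofReal_cdf, hG.cdf_zero, ENNReal.ofReal_zero]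
    exact measure_mono_null Iio_subset_Iic_self h1
  obtain ⟨q, hq, hq3, hFG⟩ :=
    IsUnitMeanLaw.of_hasFiniteTwoPlusMoment hG0 hG.mean_eq_one hGmom
  obtain ⟨CA, hCA, hA⟩ := hFE.exists_lintegral_iSup_walk_le hp hp3
  obtain ⟨CD, hCD, hD⟩ := hFG.exists_lintegral_iSup_superposition_le hq hq3
  -- half of the drift `-β √N` is given to each of the two parts
  set c : ℝ := β / 2 with hc
  have hc0 : 0 < c := by positivity
  refine ⟨2 + (1 + c) ^ 2 * CA / c + CD / c, ?_⟩
  intro N hrate Ω _ P _ u v hu hv hvind _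
  set lam : ℝ := arrivalRate β N with hlam
  have hN : 0 < N := by
    rcases Nat.eq_zero_or_pos N with h | h
    · rw [hlam, arrivalRate, h] at hrate; simp at hrate
    · exact h
  have hN0 : (0 : ℝ) < N := by exact_mod_cast hN
  have hN1 : (1 : ℝ) ≤ N := by exact_mod_cast hN
  set R : ℝ := √(N : ℝ) with hR
  have hR1 : 1 ≤ R := by rw [hR]; exact Real.one_le_sqrt.2 hN1
  have hR0 : 0 < R := by linarith
  have hRR : R * R = N := Real.mul_self_sqrt hN0.le
  have hlamR : lam = R * R - β * R := by rw [hRR]; rfl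
  have hβR : β < R := by
    have : 0 < R * (R - β) := by rw [hlamR] at hrate; linarith
    linarith [(pos_iff_pos_of_mul_pos this).1 hR0]
  have hlamN : lam ≤ N := by
    rw [hlamR, hRR]; have : 0 ≤ β * R := by positivity
    linarith
  set δ : ℝ := c / R with hδ
  have hδ0 : 0 < δ := by positivity
  have hδc : δ ≤ c := div_le_self hc0.le hR1
  have hδ1 : δ ≤ 1 := by rw [hδ, div_le_one hR0]; linarith
  have hδN : δ * N = c * R := by rw [hδ, ← hRR]; field_simp
  have ha0 : 0 < δ / (1 + δ) := by positivity
  have ha1 : δ / (1 + δ) ≤ 1 := (div_le_one (by positivity)).2 (by linarith)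
  have hx := hu.isIIDSeq_mul hrate.ne'
  set ZA : Ω → ℝ≥0∞ := fun ω => ⨆ j : ℕ, ENNReal.ofReal
    (-(∑ i ∈ Finset.range j, (lam * u (i + 1) ω - 1)) - δ / (1 + δ) * j) with hZA
  set ZD : Ω → ℝ≥0∞ := fun ω => ⨆ j : ℕ,
    ENNReal.ofReal (centredSuperposition v j ω - δ * j) with hZD
  have hZAm : Measurable ZA := Measurable.iSup fun j => (Measurable.ennreal_ofReal
    ((Finset.measurable_sum _ fun i _ => (hx.measurable i).sub_const 1).neg.sub_const _))
  have hZDm : Measurable ZD := Measurable.iSup fun j => (Measurable.ennreal_ofReal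
    ((measurable_centredSuperposition (fun i n => (hv i).measurable n) j).sub_const _))
  have hAi : ∫⁻ ω, ZA ω ∂P ≤ ENNReal.ofReal (CA / (δ / (1 + δ))) := hA hx _ ha0 ha1
  have hDi : ∫⁻ ω, ZD ω ∂P ≤ ENNReal.ofReal (CD / δ) := hD hN hv hvind δ hδ0 hδ1
  set B : Ω → ℝ≥0∞ := fun ω => (1 + ENNReal.ofReal (1 + δ) * ZA ω) + (1 + ZD ω) with hB
  have hBm : Measurable B := ((hZAm.const_mul _).const_add _).add (hZDm.const_add _)
  have hBi : ∫⁻ ω, B ω ∂P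
      ≤ ENNReal.ofReal (2 + (1 + δ) * (CA / (δ / (1 + δ))) + CD / δ) := by
    rw [hB, lintegral_add_left ((hZAm.const_mul _).const_add _),
      lintegral_add_left measurable_const, lintegral_add_left measurable_const,
      lintegral_const_mul _ hZAm]
    simp only [lintegral_const, measure_univ, mul_one]
    calc _ ≤ (1 + ENNReal.ofReal (1 + δ) * ENNReal.ofReal (CA / (δ / (1 + δ))))
          + (1 + ENNReal.ofReal (CD / δ)) := by gcongr
      _ = _ := by
        rw [← ENNReal.ofReal_mul (by positivity), ← ENNReal.ofReal_one,
          ← ENNReal.ofReal_add (by positivity) (by positivity),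
          ← ENNReal.ofReal_add (by positivity) (by positivity),
          ← ENNReal.ofReal_add (by positivity) (by positivity)]
        congr 1; ring
  have hBfin : ∀ᵐ ω ∂P, B ω ≠ ∞ := by
    filter_upwards [ae_lt_top hBm (ne_top_of_le_ne_top ENNReal.ofReal_ne_top hBi)] with ω hω
    exact hω.ne
  have hur : ∀ᵐ ω ∂P, IsRegularPath fun n => u n ω := by
    filter_upwards [hu.ae_delay_pos, hx.ae_nonneg hFE.nonneg,
      hx.ae_eventually_half_lt_walk hFE hp.le] with ω h0 h1 h2
    refine isRegularPath_of_eventually (fun n => ?_) (c := 1 / (2 * lam)) (by positivity) ?_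
    · cases n with
      | zero => exact h0.le
      | succ n => exact (mul_nonneg_iff_of_pos_left hrate).1 (h1 n)
    · filter_upwards [h2] with k hk
      rw [← Finset.mul_sum] at hk
      rw [one_div_mul_eq_div, div_lt_iff₀ (by positivity)]
      linarith
  have hvr : ∀ᵐ ω ∂P, ∀ i, IsRegularPath fun n => v i n ω :=
    ae_all_iff.2 fun i => (hv i).ae_isRegularPath hFG hq.le
  have hv0 : ∀ᵐ ω ∂P, ∀ i, renewalCount (v i) 0 ω = 0 := by
    filter_upwards [hvr, ae_all_iff.2 fun i => (hv i).ae_delay_pos] with ω h1 h2 i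
    exact (h1 i).renewalCount_zero (h2 i)
  have hmain : ∀ᵐ ω ∂P, BddAbove (range fun t : ℝ≥0 => excess u v t ω) ∧
      0 ≤ scaledSupremum u v ω ∧
      ENNReal.ofReal (scaledSupremum u v ω) ≤ ENNReal.ofReal (1 / R) * B ω := by
    filter_upwards [hBfin, hur, hvr, hv0] with ω h1 h2 h3 h4
    refine bddAbove_and_ofReal_scaledSupremum_le h1 (fun t => ?_) h4
    have h5 : excess u v t ω ≤ ((renewalCount u t ω : ℝ) - (1 + δ) * lam * t)
        + (∑ i : Fin N, ((t : ℝ) - renewalCount (v i) t ω) - δ * N * t) := by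
      have h6 : (1 + δ) * lam * t + δ * N * t ≤ N * t := by
        rw [← add_mul]
        refine mul_le_mul_of_nonneg_right ?_ t.coe_nonneg
        have h7 : δ * lam ≤ δ * N := mul_le_mul_of_nonneg_left hlamN hδ0.le
        rw [hδN] at h7
        rw [hδN, ← hRR]
        have h8 : lam + 2 * (c * R) = R * R := by rw [hlamR, hc]; ring
        linarith
      rw [excess, Finset.sum_sub_distrib]
      simp only [Finset.sum_const, Finset.card_univ, Fintype.card_fin, nsmul_eq_mul]
      linarith
    refine (ENNReal.ofReal_le_ofReal h5).trans (ENNReal.ofReal_add_le.trans ?_)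
    exact add_le_add (h2.renewalCount_sub_le hrate hδ0.le t)
      (ofReal_sum_sub_renewalCount_le hN h3 h4 hδ0.le t)
  have hsm : AEMeasurable (scaledSupremum u v) P :=
    aemeasurable_scaledSupremum hu.measurable (fun i n => (hv i).measurable n) hur hvr
  have hC0 : 0 ≤ 2 + (1 + c) ^ 2 * CA / c + CD / c := by positivity
  have hlin : ∫⁻ ω, ENNReal.ofReal (scaledSupremum u v ω) ∂P
      ≤ ENNReal.ofReal (2 + (1 + c) ^ 2 * CA / c + CD / c) := by
    calc _ ≤ ∫⁻ ω, ENNReal.ofReal (1 / R) * B ω ∂P :=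
          lintegral_mono_ae (hmain.mono fun ω h => h.2.2)
      _ = ENNReal.ofReal (1 / R) * ∫⁻ ω, B ω ∂P := lintegral_const_mul _ hBm
      _ ≤ ENNReal.ofReal (1 / R)
          * ENNReal.ofReal (2 + (1 + δ) * (CA / (δ / (1 + δ))) + CD / δ) := by gcongr
      _ ≤ _ := by
        rw [← ENNReal.ofReal_mul (by positivity)]
        refine ENNReal.ofReal_le_ofReal ?_
        have e : 1 / R * (2 + (1 + δ) * (CA / (δ / (1 + δ))) + CD / δ)
            = 2 / R + (1 + δ) ^ 2 * CA / c + CD / c := by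
          rw [hδ]; field_simp
        rw [e]
        gcongr
        exact div_le_self (by norm_num) hR1
  have hnn : 0 ≤ᵐ[P] scaledSupremum u v := hmain.mono fun ω h => h.2.1
  have hint : Integrable (scaledSupremum u v) P :=
    (lintegral_ofReal_ne_top_iff_integrable hsm.aestronglyMeasurable hnn).1
      (ne_top_of_le_ne_top ENNReal.ofReal_ne_top hlin)
  refine ⟨hmain.mono fun ω h => h.1, hint, ?_⟩
  rw [← ofReal_integral_eq_lintegral_ofReal hint hnn] at hlin
  exact (ENNReal.ofReal_le_ofReal_iff hC0).1 hlin
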